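/- Let $M$ be the closed disc $\mathbb D^2$, the annulus $\mathbb S^1\times[0,1]$ or the torus $\mathbb T^2$, with area $\mu$, flat metric, and circle action $R_t(x,y)=(x+t,y)$ (polar coordinates $(x,y)$ on the disc, with angle $2\pi x$). Let $\mathrm{Diff}^\infty(M,\mu)$ be the set of area-preserving $C^\infty$ diffeomorphisms, and let $d_k(f,g)$ be the maximum of $\tilde d_k(f,g)$ and $\tilde d_k(f^{-1},g^{-1})$, where $\tilde d_k$ is the maximum of the suprema of all partial derivatives of order $\le k$ of the coordinate functions of $f-g$ (computed in Cartesian coordinates on the universal cover; the order $0$ part is taken modulo deck translations). Let $\{\epsilon_n\}_{n\ge1}$ be a summable sequence of positive reals and $\{m_n\}_{n\ge1}$ a non-decreasing sequence of positive integers. An *AbC construction* consists of integers $p_1$, $q_1\ge1$, positive integers $k_n,l_n$ and $h_n\in\mathrm{Diff}^\infty(M,\mu)$ for $n\ge1$ such that, with $$\alpha_n=\frac{p_n}{q_n},\quad p_{n+1}=k_nl_nq_np_n+1,\quad q_{n+1}=k_nl_nq_n^2,\quad H_n=h_1\circ\dots\circ h_n,\quad T_n=H_n\circ R_{\alpha_{n+1}}\circ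 H_n^{-1}$$ ($H_0=\mathrm{id}$), one has $h_n\circ R_{\alpha_n}=R_{\alpha_n}\circ h_n$ and $d_{m_n}(T_{n-1},T_n)<\epsilon_n$ for all $n\ge 1$. A diffeomorphism $T\in\mathrm{Diff}^\infty(M,\mu)$ is a ($C^\infty$) *AbC diffeomorphism* if $d_k(T_n,T)\to0$ for every $k$ for some such construction; $T$ is then called the limit of the construction. A *scale* is a family of sequences $a_n(t)$, $t>0$, with $a_n(t)\to\infty$ as $n\to\infty$ for every $t>0$, which for all sufficiently large $n$ is positive, non-decreasing in $n$ and non-decreasing in $t$. For a homeomorphism $T$ of a metric space $X$, compact $K\subset X$ and $\epsilon>0$ let $N_{n,K}(\epsilon)$ be the minimal number of balls of radius $\epsilon$ in the metric $\max_{0\le i<n}d(T^ix,T^iy)$ needed to cover $K$. The *upper topological slow entropy* is $$\overline{\operatorname{ent}}^{\operatorname{top}}_{a_n(t)}(T)=\sup_K\lim_{\epsilon\to0}\sup\Big\{t>0:\limsup_{n\to\infty}\frac{N_{n,K}(\epsilon)}{a_n(t)}>0\Big\},\qquad \sup\emptyset=0.$$ **Theorem.** Assume that $\epsilon_{n_0}>\sum_{n>n_0}\epsilon_n$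 for all sufficiently large $n_0$. Then for any scale $a_n(t)$ there is an AbC diffeomorphism $T$ of $M$ (for the given $\{\epsilon_n\}$, $\{m_n\}$) with $\overline{\operatorname{ent}}^{\operatorname{top}}_{a_n(t)}(T)=0$. Moreover, such a $T$ can be found whatever the conjugations are: for all $p_1$ and $q_1\ge1$, and for any rule which prescribes, at each stage $n$, from all the choices made in the stages before $n$, an admissible pair $(k_n,h_n)$ (that is, $k_n\geq 1$ and $h_n\in\mathrm{Diff}^\infty(M,\mu)$ commutes with $R_{\alpha_n}$), the remaining parameters $l_n$ can be chosen such that one gets an AbC construction with these $(k_n,h_n)$ which has a limit $T$ with $\overline{\operatorname{ent}}^{\operatorname{top}}_{a_n(t)}(T)=0$. -/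

import Mathlib

open Set Filter Topology MeasureTheory
open scoped ENNReal ContDiff

noncomputable section

/-! ### Upper topological slow entropy -/

/-- A scale: a family `a n t`, `t > 0`, of sequences which are positive, increasing in `n`,
increasing in `t`, and which tend to infinity with `n`. The first three properties are only asked
for large `n`, so that for instance `a n t = (log n) ^ t` is a scale. -/
structure IsScale (a : ℕ → ℝ → ℝ) : Prop where
  eventually_pos : ∃ N, ∀ n ≥ N, ∀ t > 0, 0 < a n t
  eventually_mono_index : ∃ N, ∀ n ≥ N, ∀ n' ≥ n, ∀ t > 0, a n t ≤ a n' t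
  eventually_mono_param : ∃ N, ∀ n ≥ N, ∀ t > 0, ∀ t' ≥ t, a n t ≤ a n t'
  tendsto_atTop : ∀ t > 0, Tendsto (fun n => a n t) atTop atTop

section Entropy

variable {X : Type*} [PseudoMetricSpace X]

/-- The `(ε, n)`-Bowen ball around `x`: all `y` with `max_{0 ≤ i < n} d (T^i x, T^i y) < ε`. -/
def bowenBall (T : X ≃ₜ X) (n : ℕ) (ε : ℝ) (x : X) : Set X :=
  {y | ∀ i < n, dist (T^[i] x) (T^[i] y) < ε}

/-- The minimal number of `(ε, n)`-Bowen balls which cover `K`. -/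
def bowenCoveringNumber (T : X ≃ₜ X) (K : Set X) (ε : ℝ) (n : ℕ) : ℕ∞ :=
  ⨅ (C : Finset X) (_ : K ⊆ ⋃ x ∈ C, bowenBall T n ε x), (C.card : ℕ∞)

/-- The supremum of all `t > 0` with `limsup_n N(n, ε, K) / a n t > 0` (it is `0` if there is no
such `t`). -/
def slowEntropyAt (a : ℕ → ℝ → ℝ) (T : X ≃ₜ X) (K : Set X) (ε : ℝ) : ℝ≥0∞ :=
  ⨆ (t : ℝ) (_ : 0 < t ∧ 0 < limsup
    (fun n : ℕ => (bowenCoveringNumber T K ε n : ℝ≥0∞) / ENNReal.ofReal (a n t)) atTop),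
    ENNReal.ofReal t

/-- The upper topological slow entropy `sup_K lim_{ε → 0}` of `slowEntropyAt`, over all compact
`K`. Since `slowEntropyAt` grows when `ε` decreases, the limit is a supremum over `ε > 0`. -/
def upperTopSlowEntropy (a : ℕ → ℝ → ℝ) (T : X ≃ₜ X) : ℝ≥0∞ :=
  ⨆ (K : Set X) (_ : IsCompact K) (ε : ℝ) (_ : 0 < ε), slowEntropyAt a T K ε

end Entropy

/-! ### The three surfaces

The plane is `ℂ`, with coordinates `x = re` and `y = im`. Each surface is the quotient of a closed
convex planar set by a group of integer translations, with the flat metric. -/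

/-- The disc `𝔻²`, the annulus `𝕊¹ × [0, 1]` and the torus `𝕋²`. -/
inductive Surface where
  | disc
  | annulus
  | torus

namespace Surface

/-- The universal cover: the closed unit disc, the strip `ℝ × [0, 1]`, the plane. -/
def domain : Surface → Set ℂ
  | disc => Metric.closedBall 0 1
  | annulus => {z | 0 ≤ z.im ∧ z.im ≤ 1}
  | torus => univ

/-- The translations by which the universal cover is divided: `0`, `ℤ × 0`, `ℤ × ℤ`. -/
def deck : Surface → AddSubgroup ℂ
  | disc => ⊥
  | annulus => AddSubgroup.closure {1}
  | torus => AddSubgroup.closure {1, Complex.I}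

/-- A compact region of the universal cover which maps onto the surface, injectively up to
boundary points: the closed disc, and the unit square for the other two surfaces. -/
def cell : Surface → Set ℂ
  | disc => Metric.closedBall 0 1
  | annulus => {z | (0 ≤ z.re ∧ z.re ≤ 1) ∧ 0 ≤ z.im ∧ z.im ≤ 1}
  | torus => {z | (0 ≤ z.re ∧ z.re ≤ 1) ∧ 0 ≤ z.im ∧ z.im ≤ 1}

variable (S : Surface)

/-- The points of the surface. -/
def Pt : Type := {w : ℂ ⧸ S.deck // ∃ z ∈ S.domain, (z : ℂ ⧸ S.deck) = w}

instance : PseudoMetricSpace S.Pt :=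
  inferInstanceAs (PseudoMetricSpace {w : ℂ ⧸ S.deck // ∃ z ∈ S.domain, (z : ℂ ⧸ S.deck) = w})

instance : MeasurableSpace S.Pt := borel S.Pt

instance : BorelSpace S.Pt := ⟨rfl⟩

/-- The universal covering map. -/
def proj (z : S.domain) : S.Pt := ⟨((z : ℂ) : ℂ ⧸ S.deck), z, z.2, rfl⟩

/-- The area measure `μ` of the surface. -/
def area : Measure S.Pt :=
  (((volume : Measure ℂ).restrict S.cell).comap ((↑) : S.domain → ℂ)).map S.proj

/-! ### The circle action -/

/-- The lift of `R_t` to the universal cover: `(x, y) ↦ (x + t, y)`, in Cartesian coordinates for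
the annulus and the torus, and in polar coordinates, `x` being the angle divided by `2 π`, for the
disc. -/
def rotLift : Surface → ℝ → ℂ → ℂ
  | disc, t, z => Complex.exp (2 * Real.pi * t * Complex.I) * z
  | annulus, t, z => t + z
  | torus, t, z => t + z

lemma rotLift_mem (t : ℝ) {z : ℂ} (hz : z ∈ S.domain) : S.rotLift t z ∈ S.domain := by
  cases S with
  | disc =>
    have h : ‖Complex.exp (2 * Real.pi * t * Complex.I)‖ = 1 := by
      have := Complex.norm_exp_ofReal_mul_I (2 * Real.pi * t)
      push_cast at this
      exact this
    simpa [domain, rotLift, h] using hz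
  | annulus => simpa [domain, rotLift] using hz
  | torus => trivial

lemma rotLift_deck (t : ℝ) {z w : ℂ} (h : -z + w ∈ S.deck) :
    -S.rotLift t z + S.rotLift t w ∈ S.deck := by
  cases S with
  | disc =>
    have h' : -z + w = 0 := by simpa [deck] using h
    have : w = z := by linear_combination h'
    simp [rotLift, this, deck]
  | annulus => simpa [rotLift] using h
  | torus => simpa [rotLift] using h

lemma continuous_rotLift (t : ℝ) : Continuous (S.rotLift t) := by
  cases S <;> unfold rotLift <;> fun_prop

lemma rotLift_add (s t : ℝ) (z : ℂ) : S.rotLift s (S.rotLift t z) = S.rotLift (s + t) z := by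
  cases S with
  | disc =>
    simp only [rotLift]
    rw [← mul_assoc, ← Complex.exp_add]
    push_cast
    ring_nf
  | annulus => simp [rotLift, add_assoc]
  | torus => simp [rotLift, add_assoc]

lemma rotLift_zero (z : ℂ) : S.rotLift 0 z = z := by
  cases S <;> simp [rotLift]

/-- The map which `R_t` induces on the quotient of the plane. -/
def rotQuot (t : ℝ) : ℂ ⧸ S.deck → ℂ ⧸ S.deck :=
  Quotient.map' (S.rotLift t) fun _ _ h => by
    rw [QuotientAddGroup.leftRel_apply] at h ⊢
    exact S.rotLift_deck t h

lemma rotQuot_mk (t : ℝ) (z : ℂ) :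
    S.rotQuot t (z : ℂ ⧸ S.deck) = (S.rotLift t z : ℂ ⧸ S.deck) := rfl

lemma continuous_rotQuot (t : ℝ) : Continuous (S.rotQuot t) :=
  (S.continuous_rotLift t).quotient_map' _

lemma rotQuot_add (s t : ℝ) (w : ℂ ⧸ S.deck) :
    S.rotQuot s (S.rotQuot t w) = S.rotQuot (s + t) w := by
  induction w using QuotientAddGroup.induction_on with
  | H z => simp only [rotQuot_mk, rotLift_add]

lemma rotQuot_zero (w : ℂ ⧸ S.deck) : S.rotQuot 0 w = w := by
  induction w using QuotientAddGroup.induction_on with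
  | H z => simp only [rotQuot_mk, rotLift_zero]

/-- The map `R_t` of the surface. -/
def rotFun (t : ℝ) (w : S.Pt) : S.Pt :=
  ⟨S.rotQuot t w.1, by
    obtain ⟨z, hz, h⟩ := w.2
    exact ⟨S.rotLift t z, S.rotLift_mem t hz, by rw [← h, rotQuot_mk]⟩⟩

lemma continuous_rotFun (t : ℝ) : Continuous (S.rotFun t) :=
  Continuous.subtype_mk ((S.continuous_rotQuot t).comp continuous_subtype_val) _

/-- The homeomorphism `R_t` of the surface. -/
def rot (t : ℝ) : S.Pt ≃ₜ S.Pt where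
  toFun := S.rotFun t
  invFun := S.rotFun (-t)
  left_inv w := Subtype.ext (by simp only [rotFun, rotQuot_add, neg_add_cancel, rotQuot_zero])
  right_inv w := Subtype.ext (by simp only [rotFun, rotQuot_add, add_neg_cancel, rotQuot_zero])
  continuous_toFun := S.continuous_rotFun t
  continuous_invFun := S.continuous_rotFun (-t)

/-! ### Smooth diffeomorphisms and their distances -/

variable {S}

/-- `F` is a continuous lift of `f` to the universal cover (only its values on `S.domain` matter). -/
structure IsLift (f : S.Pt ≃ₜ S.Pt) (F : ℂ → ℂ) : Prop where
  continuousOn : ContinuousOn F S.domain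
  mapsTo : MapsTo F S.domain S.domain
  proj_eq : ∀ z : S.domain, (f (S.proj z)).1 = (F z : ℂ ⧸ S.deck)

/-- `f` belongs to `Diff^∞(M, μ)`: `f` and its inverse are smooth, up to the boundary, and `f`
preserves the area. -/
structure IsSmoothDiffeo (f : S.Pt ≃ₜ S.Pt) : Prop where
  smooth : ∃ F, IsLift f F ∧ ContDiffOn ℝ ∞ F S.domain
  smooth_symm : ∃ F, IsLift f.symm F ∧ ContDiffOn ℝ ∞ F S.domain
  measurePreserving : MeasurePreserving f S.area S.area

/-- The value at `z` of the iterated partial derivative of `F` in the coordinate directions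
`s 0, …, s (j - 1)`, where direction `0` is `x` and direction `1` is `y`. -/
def partialDeriv (S : Surface) (F : ℂ → ℂ) {j : ℕ} (s : Fin j → Fin 2) (z : ℂ) : ℂ :=
  iteratedFDerivWithin ℝ j F S.domain z fun i => (![1, Complex.I] : Fin 2 → ℂ) (s i)

/-- The largest supremum over the cell of a partial derivative of order at most `k` (the order `0`
included) of a coordinate function of `F`. -/
def liftNorm (S : Surface) (k : ℕ) (F : ℂ → ℂ) : ℝ≥0∞ :=
  ⨆ (j : ℕ) (_ : j ≤ k) (s : Fin j → Fin 2) (z : ℂ) (_ : z ∈ S.cell),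
    ENNReal.ofReal (max |(partialDeriv S F s z).re| |(partialDeriv S F s z).im|)

/-- The one-sided distance `d̃_k`. The lifts of `f` and `g` are unique up to deck translations,
which affect the order `0` part only, so that the infimum over the lifts is the infimum over
integer translations of that part. -/
def semiDist (k : ℕ) (f g : S.Pt ≃ₜ S.Pt) : ℝ≥0∞ :=
  ⨅ (F : ℂ → ℂ) (_ : IsLift f F) (G : ℂ → ℂ) (_ : IsLift g G), liftNorm S k (fun z => F z - G z)

/-- The distance `d_k` of `C^k` diffeomorphisms. -/
def diffDist (k : ℕ) (f g : S.Pt ≃ₜ S.Pt) : ℝ≥0∞ :=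
  max (semiDist k f g) (semiDist k f.symm g.symm)

end Surface

/-! ### Approximation by conjugation

Stages are counted from `0`. A history is the list of the stages `n - 1, …, 1, 0`, the latest one
first; the pair `p₀, q₀` gives the initial rational `p₀ / q₀`. -/

namespace AbC

open Surface

/-- What is chosen in one stage: the integers `k`, `l` and the diffeomorphism `h`. -/
structure Stage (S : Surface) where
  k : ℕ
  l : ℕ
  h : S.Pt ≃ₜ S.Pt

variable {S : Surface}

/-- The denominators `q`: they satisfy `q' = k l q ^ 2`. -/
def den (q₀ : ℕ) : List (Stage S) → ℕ
  | [] => q₀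
  | s :: w => s.k * s.l * den q₀ w ^ 2

/-- The numerators `p`: they satisfy `p' = k l q p + 1`. -/
def num (p₀ : ℤ) (q₀ : ℕ) : List (Stage S) → ℤ
  | [] => p₀
  | s :: w => s.k * s.l * den q₀ w * num p₀ q₀ w + 1

/-- The rational `α = p / q`; thus `α' = α + 1 / (k l q ^ 2)`. -/
def alpha (p₀ : ℤ) (q₀ : ℕ) (w : List (Stage S)) : ℝ := num p₀ q₀ w / den q₀ w

/-- The conjugation `H`: it satisfies `H' = H ∘ h`, and is the identity in the beginning. -/
def conj : List (Stage S) → (S.Pt ≃ₜ S.Pt)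
  | [] => Homeomorph.refl S.Pt
  | s :: w => s.h.trans (conj w)

/-- The approximation `H ∘ R_α ∘ H⁻¹`. -/
def approx (p₀ : ℤ) (q₀ : ℕ) (w : List (Stage S)) : S.Pt ≃ₜ S.Pt :=
  ((conj w).symm.trans (S.rot (alpha p₀ q₀ w))).trans (conj w)

/-- `k` and `h` may be chosen after the history `w`: `k` is positive, `h` is a smooth area
preserving diffeomorphism, and `h ∘ R_α = R_α ∘ h`. -/
structure Allowed (p₀ : ℤ) (q₀ : ℕ) (w : List (Stage S)) (k : ℕ) (h : S.Pt ≃ₜ S.Pt) : Prop where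
  k_pos : 0 < k
  diffeo : IsSmoothDiffeo h
  comm : ∀ x, h (S.rot (alpha p₀ q₀ w) x) = S.rot (alpha p₀ q₀ w) (h x)

/-- A finite history all of whose stages are allowed. -/
def ValidHistory (p₀ : ℤ) (q₀ : ℕ) : List (Stage S) → Prop
  | [] => True
  | s :: w => ValidHistory p₀ q₀ w ∧ 0 < s.l ∧ Allowed p₀ q₀ w s.k s.h

/-- The history of an infinite sequence of stages before stage `n`. -/
def history (c : ℕ → Stage S) : ℕ → List (Stage S)
  | 0 => []
  | n + 1 => c n :: history c n

/-- The sequence of stages `c` is an AbC construction for the sequences `ε` and `m`. -/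
structure IsConstruction (ε : ℕ → ℝ) (m : ℕ → ℕ) (p₀ : ℤ) (q₀ : ℕ) (c : ℕ → Stage S) : Prop where
  q_pos : 0 < q₀
  l_pos : ∀ n, 0 < (c n).l
  allowed : ∀ n, Allowed p₀ q₀ (history c n) (c n).k (c n).h
  close : ∀ n, diffDist (m n) (approx p₀ q₀ (history c n)) (approx p₀ q₀ (history c (n + 1)))
    < ENNReal.ofReal (ε n)

/-- The approximations of the construction `c` converge to `T` in `Diff^∞(M, μ)`. -/
structure ConvergesTo (p₀ : ℤ) (q₀ : ℕ) (c : ℕ → Stage S) (T : S.Pt ≃ₜ S.Pt) : Prop where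
  diffeo : IsSmoothDiffeo T
  tendsto : ∀ k, Tendsto (fun n => diffDist k (approx p₀ q₀ (history c n)) T) atTop (𝓝 0)

/-- `T` is a (smooth) AbC diffeomorphism for the sequences `ε` and `m`. -/
def IsAbCDiffeo (ε : ℕ → ℝ) (m : ℕ → ℕ) (T : S.Pt ≃ₜ S.Pt) : Prop :=
  ∃ (p₀ : ℤ) (q₀ : ℕ) (c : ℕ → Stage S), IsConstruction ε m p₀ q₀ c ∧ ConvergesTo p₀ q₀ c T

/-- A rule which prescribes `k` and `h` in each stage, from the history of the construction. -/
structure Rule (S : Surface) where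
  k : List (Stage S) → ℕ
  h : List (Stage S) → (S.Pt ≃ₜ S.Pt)

/-- The rule always prescribes an allowed choice. -/
def Rule.IsAdmissible (ρ : Rule S) (p₀ : ℤ) (q₀ : ℕ) : Prop :=
  ∀ w, ValidHistory p₀ q₀ w → Allowed p₀ q₀ w (ρ.k w) (ρ.h w)

/-- The construction `c` obeys the rule. -/
def Rule.IsObeyedBy (ρ : Rule S) (c : ℕ → Stage S) : Prop :=
  ∀ n, (c n).k = ρ.k (history c n) ∧ (c n).h = ρ.h (history c n)

end AbC

end

/-! ### Uniform limits of smooth maps on convex sets -/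

section Calculus

variable {E F : Type*} [NormedAddCommGroup E] [NormedSpace ℝ E] [NormedAddCommGroup F]
  [NormedSpace ℝ F]

/-! Write `H` for the conjugation after a stage, including the newly prescribed `h`. Since `h`
commutes with `R_α`, the old approximation is also `H ∘ R_α ∘ H⁻¹` (`approx_eq_rotConj_of_allowed`),
and the new one is `H ∘ R_α' ∘ H⁻¹` with `α' = α + 1 / (k l q ^ 2)`. As `l` grows with `k`, `h` and
`q` fixed, the new map tends to the old one in every `C^k` distance, together with its inverse and
with all orbits up to any prescribed time (`exists_isCloseStep`).

The rotations are 1-Lipschitz, so the maps `H ∘ R_t ∘ H⁻¹`, `t ∈ ℝ`, are uniformly equicontinuous.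
One finite set `C` therefore serves as a net for the Bowen metrics of all these maps and all times
(`exists_finset_rotConj`). It depends on `H` but not on `l`. A scale tends to infinity, so there is
a time `M` after which `a` dominates the cardinality of `C`; only then is `l` chosen, so large that
orbits are unchanged up to a small error until time `M`. Between the thresholds of two successive
stages the limit `T` follows an approximation whose covering numbers are bounded by the earlier net,
already negligible against `a` (`upperTopSlowEntropy_eq_zero_of_approximation`).

The existence of `T` is completeness: geometrically small perturbations of lifts, with all
derivatives on growing balls, sum to a smooth lift, and so do those of the inverses
(`exists_limit`). -/

theorem Convex.hasFDerivWithinAt_of_tendstoUniformlyOn {s : Set E} (hs : Convex ℝ s)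
    {f : ℕ → E → F} {f' : ℕ → E → E →L[ℝ] F} {g : E → F} {g' : E → E →L[ℝ] F}
    (hf : ∀ n, ∀ x ∈ s, HasFDerivWithinAt (f n) (f' n x) s x)
    (hg : ∀ x ∈ s, Tendsto (fun n => f n x) atTop (𝓝 (g x)))
    (hg' : TendstoUniformlyOn f' g' atTop s) {x : E} (hx : x ∈ s) :
    HasFDerivWithinAt g (g' x) s x := by
  rw [hasFDerivWithinAt_iff_isLittleO, Asymptotics.isLittleO_iff]
  intro c hc
  -- The error `c` is split into `c / 2` for `g - f N`, `c / 4` for the differentiability of `f N`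
  -- and `c / 4` for `f' N - g'`. The first part is the mean value inequality for `f n - f N` on the
  -- convex set, in the limit `n → ∞`.
  have hc4 : 0 < c / 4 := by positivity
  obtain ⟨N, hN⟩ := eventually_atTop.1 (Metric.tendstoUniformlyOn_iff.1 hg' (c / 4) hc4)
  have key : ∀ y ∈ s, ‖(g y - f N y) - (g x - f N x)‖ ≤ c / 2 * ‖y - x‖ := by
    intro y hy
    have ht : Tendsto (fun n => ‖(f n y - f N y) - (f n x - f N x)‖) atTop
        (𝓝 ‖(g y - f N y) - (g x - f N x)‖) :=
      (((hg y hy).sub_const _).sub ((hg x hx).sub_const _)).norm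
    refine le_of_tendsto ht ?_
    filter_upwards [eventually_ge_atTop N] with n hn
    refine Convex.norm_image_sub_le_of_norm_hasFDerivWithin_le (f := fun y => f n y - f N y)
      (f' := fun y => f' n y - f' N y) (fun z hz => (hf n z hz).sub (hf N z hz)) (fun z hz => ?_)
      hs hx hy
    have h1 := hN n hn z hz
    have h2 := hN N le_rfl z hz
    rw [← dist_eq_norm]
    linarith [dist_triangle_left (f' n z) (f' N z) (g' z)]
  have hN' := Asymptotics.isLittleO_iff.1 (hasFDerivWithinAt_iff_isLittleO.1 (hf N x hx)) hc4
  filter_upwards [hN', self_mem_nhdsWithin] with y hy hys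
  have h1 := key y hys
  have h2 : ‖(f' N x - g' x) (y - x)‖ ≤ c / 4 * ‖y - x‖ :=
    ContinuousLinearMap.le_of_opNorm_le _ (by
      rw [← dist_eq_norm, dist_comm]; exact (hN N le_rfl x hx).le) _
  have h3 : g y - g x - g' x (y - x) = ((g y - f N y) - (g x - f N x))
      + (f N y - f N x - f' N x (y - x)) + (f' N x - g' x) (y - x) := by
    simp only [sub_apply]; abel
  rw [h3]
  refine (norm_add₃_le ..).trans ?_
  linarith

/-- A sequence of smooth maps on a convex set, all of whose derivatives are uniformly Cauchy on
bounded parts of the set, has a smooth limit, and the derivatives converge. -/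
theorem exists_contDiffOn_limit [CompleteSpace F] {s : Set E} (hs : Convex ℝ s)
    (hu : UniqueDiffOn ℝ s) {f : ℕ → E → F} (hf : ∀ n, ContDiffOn ℝ ∞ (f n) s)
    (hc : ∀ (j : ℕ) (r : ℝ), UniformCauchySeqOn (fun n => iteratedFDerivWithin ℝ j (f n) s) atTop
      (s ∩ Metric.closedBall 0 r)) :
    ∃ g : E → F, ContDiffOn ℝ ∞ g s ∧ ∀ (j : ℕ) (r : ℝ),
      TendstoUniformlyOn (fun n => iteratedFDerivWithin ℝ j (f n) s)
        (iteratedFDerivWithin ℝ j g s) atTop (s ∩ Metric.closedBall 0 r) := by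
  have hlim : ∀ x ∈ s, ∀ j, ∃ L, Tendsto (fun n => iteratedFDerivWithin ℝ j (f n) s x) atTop
      (𝓝 L) := fun x hx j =>
    cauchySeq_tendsto_of_complete ((hc j ‖x‖).cauchySeq ⟨hx, by simp⟩)
  choose! p hp using hlim
  have hunif : ∀ j r, TendstoUniformlyOn (fun n => iteratedFDerivWithin ℝ j (f n) s)
      (fun x => p x j) atTop (s ∩ Metric.closedBall 0 r) := fun j r =>
    (hc j r).tendstoUniformlyOn_of_tendsto fun x hx => hp x hx.1 j
  have hderiv : ∀ n (j : ℕ), ∀ x ∈ s, HasFDerivWithinAt (iteratedFDerivWithin ℝ j (f n) s)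
      ((iteratedFDerivWithin ℝ (j + 1) (f n) s x).curryLeft) s x := fun n j x hx =>
    ((hf n).ftaylorSeriesWithin hu).fderivWithin j (by exact_mod_cast ENat.natCast_lt_top j) x hx
  -- Uniform convergence is only known on bounded parts; this one is convex and a neighbourhood of
  -- `x` within `s`, so derivatives there are derivatives within `s`.
  have hnear : ∀ x : E, s ∩ Metric.closedBall 0 (‖x‖ + 1) ∈ 𝓝[s] x := fun x => by
    refine inter_mem_nhdsWithin _ (Metric.closedBall_mem_nhds_of_mem (by simp))
  -- The pointwise limits of the derivatives form a Taylor series of the order `0` limit; uniqueness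
  -- of derivatives identifies them afterwards.
  have htaylor : HasFTaylorSeriesUpToOn ∞ (fun x => (p x 0).curry0) p s := by
    refine ⟨fun _ _ => rfl, fun j _ x hx => ?_, fun j _ x hx => ?_⟩
    · have := Convex.hasFDerivWithinAt_of_tendstoUniformlyOn
        (s := s ∩ Metric.closedBall 0 (‖x‖ + 1)) (hs.inter (convex_closedBall _ _))
        (f := fun n => iteratedFDerivWithin ℝ j (f n) s) (g := fun x => p x j)
        (f' := fun n y => (iteratedFDerivWithin ℝ (j + 1) (f n) s y).curryLeft)
        (g' := fun y => (p y (j + 1)).curryLeft)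
        (fun n y hy => (hderiv n j y hy.1).mono inter_subset_left) (fun y hy => hp y hy.1 j) ?_
        (x := x) ⟨hx, by simp⟩
      · exact this.mono_of_mem_nhdsWithin (hnear x)
      · exact (continuousMultilinearCurryLeftEquiv ℝ (fun _ : Fin (j + 1) => E)
          F).isometry.uniformContinuous.comp_tendstoUniformlyOn (hunif (j + 1) (‖x‖ + 1))
    · have : ContinuousOn (fun x => p x j) (s ∩ Metric.closedBall 0 (‖x‖ + 1)) :=
        (hunif j _).continuousOn (Eventually.frequently (Eventually.of_forall fun n =>
          ((hf n).continuousOn_iteratedFDerivWithin (by exact_mod_cast le_top) hu).mono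
            inter_subset_left))
      exact (this x ⟨hx, by simp⟩).mono_of_mem_nhdsWithin (hnear x)
  refine ⟨_, htaylor.contDiffOn, fun j r => ?_⟩
  refine (hunif j r).congr_right fun x hx => ?_
  exact htaylor.eq_iteratedFDerivWithin_of_uniqueDiffOn (by exact_mod_cast le_top) hu hx.1

/-- Differentiating in the second variable alone preserves joint smoothness, by induction on the
order. This gives continuity in the rotation angle of all derivatives of a conjugated rotation. -/
theorem ContDiffOn.iteratedFDerivWithin_param {P : Type*} [NormedAddCommGroup P] [NormedSpace ℝ P]
    {f : P → E → F} {s : Set E} (hu : UniqueDiffOn ℝ s)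
    (hf : ContDiffOn ℝ ∞ (fun q : P × E => f q.1 q.2) (univ ×ˢ s)) (j : ℕ) :
    ContDiffOn ℝ ∞ (fun q : P × E => iteratedFDerivWithin ℝ j (f q.1) s q.2) (univ ×ˢ s) := by
  induction j with
  | zero =>
    simp only [iteratedFDerivWithin_zero_eq_comp]
    exact (continuousMultilinearCurryFin0 ℝ E F).symm.contDiff.comp_contDiffOn hf
  | succ j ih =>
    simp only [iteratedFDerivWithin_succ_eq_comp_left]
    have h : ContDiffOn ℝ ∞ (fun q : P × E =>
        fderivWithin ℝ (iteratedFDerivWithin ℝ j (f q.1) s) s q.2) (univ ×ˢ s) := fun q hq => by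
      refine ContDiffWithinAt.fderivWithin (n := ∞) (t := s)
        (f := fun (q : P × E) => iteratedFDerivWithin ℝ j (f q.1) s) ?_ contDiffWithinAt_snd hu
        (by simp) hq (fun q hq => hq.2)
      -- The whole pair `q` acts as the parameter of the family, which ignores its second component.
      exact ContDiffWithinAt.comp (t := univ ×ˢ s) (f := fun z : (P × E) × E => (z.1.1, z.2))
        (q, q.2) (ih q hq) (by fun_prop) fun z hz => ⟨mem_univ _, hz.2⟩
    exact (continuousMultilinearCurryLeftEquiv ℝ (fun _ : Fin (j + 1) => E)
      F).symm.toContinuousLinearEquiv.comp_contDiffOn_iff.2 h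

/-- In a smooth family of smooth maps, every derivative depends continuously on the parameter,
uniformly on compact sets. -/
theorem ContDiffOn.eventually_norm_iteratedFDerivWithin_sub_lt {P : Type*} [NormedAddCommGroup P]
    [NormedSpace ℝ P] {f : P → E → F} {s K : Set E} (hu : UniqueDiffOn ℝ s)
    (hf : ContDiffOn ℝ ∞ (fun q : P × E => f q.1 q.2) (univ ×ˢ s)) (hK : IsCompact K)
    (hKs : K ⊆ s) (j : ℕ) (p₀ : P) {δ : ℝ} (hδ : 0 < δ) :
    ∀ᶠ p in 𝓝 p₀, ∀ x ∈ K,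
      ‖iteratedFDerivWithin ℝ j (fun x => f p x - f p₀ x) s x‖ < δ := by
  have hc := ((hf.iteratedFDerivWithin_param hu j).continuousOn).mono (prod_mono_right hKs)
  have hsm : ∀ p, ContDiffOn ℝ ∞ (f p) s := fun p =>
    hf.comp (f := fun x => (p, x)) (by fun_prop) fun x hx => ⟨mem_univ _, hx⟩
  have h := hK.mem_uniformity_of_prod
    (f := fun p x => iteratedFDerivWithin ℝ j (f p) s x) hc (mem_univ p₀)
    (Metric.dist_mem_uniformity hδ)
  rw [nhdsWithin_univ] at h
  obtain ⟨v, hv, hvd⟩ := h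
  filter_upwards [hv] with p hp x hx
  have := hvd p hp x hx
  rw [fun_iteratedFDerivWithin_sub_apply ((hsm p x (hKs hx)).of_le (by exact_mod_cast le_top))
    ((hsm p₀ x (hKs hx)).of_le (by exact_mod_cast le_top)) hu (hKs hx), ← dist_eq_norm]
  exact this

end Calculus

namespace Surface

variable (S : Surface)

/-! ### The surfaces as compact metric spaces -/

/-- Closedness makes the quotient Hausdorff, so that limits on the surface are unique. -/
theorem isClosed_deck : IsClosed (S.deck : Set ℂ) := by
  have hZ : IsClosed (range ((↑) : ℤ → ℝ)) := Int.isClosedEmbedding_coe_real.isClosed_range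
  cases S with
  | disc => simp [deck]
  | annulus =>
    have : ((deck annulus : AddSubgroup ℂ) : Set ℂ)
        = Complex.re ⁻¹' range ((↑) : ℤ → ℝ) ∩ Complex.im ⁻¹' {0} := by
      ext z
      simp only [deck, SetLike.mem_coe, AddSubgroup.mem_closure_singleton, mem_inter_iff,
        mem_preimage, mem_range, mem_singleton_iff, Complex.ext_iff]
      simp [eq_comm]
    rw [this]
    exact (hZ.preimage Complex.continuous_re).inter (isClosed_singleton.preimage
      Complex.continuous_im)
  | torus =>
    have : ((deck torus : AddSubgroup ℂ) : Set ℂ)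
        = Complex.re ⁻¹' range ((↑) : ℤ → ℝ) ∩ Complex.im ⁻¹' range ((↑) : ℤ → ℝ) := by
      ext z
      simp only [deck, SetLike.mem_coe, AddSubgroup.mem_closure_pair, mem_inter_iff,
        mem_preimage, mem_range, Complex.ext_iff]
      simp
    rw [this]
    exact (hZ.preimage Complex.continuous_re).inter (hZ.preimage Complex.continuous_im)

theorem isClosed_domain : IsClosed S.domain := by
  cases S with
  | disc => exact Metric.isClosed_closedBall
  | annulus =>
    exact (isClosed_le continuous_const Complex.continuous_im).inter
      (isClosed_le Complex.continuous_im continuous_const)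
  | torus => exact isClosed_univ

theorem convex_domain : Convex ℝ S.domain := by
  cases S with
  | disc => exact convex_closedBall _ _
  | annulus => exact (convex_halfSpace_im_ge 0).inter (convex_halfSpace_im_le 1)
  | torus => exact convex_univ

theorem uniqueDiffOn_domain : UniqueDiffOn ℝ S.domain := by
  refine uniqueDiffOn_convex S.convex_domain ?_
  cases S with
  | disc => exact ⟨0, Metric.ball_subset_interior_closedBall (by simp)⟩
  | annulus =>
    refine ⟨Complex.I / 2, mem_interior.2 ⟨{z | 0 < z.im} ∩ {z | z.im < 1}, fun z hz => ?_,
      (isOpen_lt continuous_const Complex.continuous_im).inter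
      (isOpen_lt Complex.continuous_im continuous_const), ?_⟩⟩
    · exact ⟨hz.1.le, hz.2.le⟩
    · constructor <;> norm_num
  | torus => simp [domain]

theorem add_mem_domain {z d : ℂ} (hz : z ∈ S.domain) (hd : d ∈ S.deck) : z + d ∈ S.domain := by
  cases S with
  | disc =>
    have : d = 0 := by simpa [deck] using hd
    simpa [this] using hz
  | annulus =>
    obtain ⟨n, rfl⟩ := AddSubgroup.mem_closure_singleton.1 hd
    simpa [domain] using hz
  | torus => trivial

theorem isCompact_square : IsCompact {z : ℂ | (0 ≤ z.re ∧ z.re ≤ 1) ∧ 0 ≤ z.im ∧ z.im ≤ 1} :=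
  isCompact_Icc.reProdIm isCompact_Icc

theorem isCompact_cell : IsCompact S.cell := by
  cases S with
  | disc => exact isCompact_closedBall _ _
  | annulus => exact isCompact_square
  | torus => exact isCompact_square

theorem cell_subset_domain : S.cell ⊆ S.domain := by
  cases S with
  | disc => exact subset_rfl
  | annulus => exact fun z hz => hz.2
  | torus => exact subset_univ _

theorem square_subset_closedBall :
    {z : ℂ | (0 ≤ z.re ∧ z.re ≤ 1) ∧ 0 ≤ z.im ∧ z.im ≤ 1} ⊆ Metric.closedBall 0 2 := fun z hz => by
  obtain ⟨⟨h1, h2⟩, h3, h4⟩ := hz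
  rw [mem_closedBall_zero_iff]
  refine (Complex.norm_le_abs_re_add_abs_im z).trans ?_
  rw [abs_of_nonneg h1, abs_of_nonneg h3]
  linarith

theorem cell_subset_closedBall : S.cell ⊆ Metric.closedBall 0 2 := by
  cases S with
  | disc => exact Metric.closedBall_subset_closedBall (by norm_num)
  | annulus => exact square_subset_closedBall
  | torus => exact square_subset_closedBall

theorem exists_mem_cell {z : ℂ} (hz : z ∈ S.domain) :
    ∃ c ∈ S.cell, (c : ℂ ⧸ S.deck) = z := by
  have h : ∀ x : ℝ, 0 ≤ x - ⌊x⌋ ∧ x - ⌊x⌋ ≤ 1 := fun x =>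
    ⟨Int.fract_nonneg x, (Int.fract_lt_one x).le⟩
  cases S with
  | disc => exact ⟨z, hz, rfl⟩
  | annulus =>
    refine ⟨z - ⌊z.re⌋, ⟨by simpa using h z.re, by simpa using! hz⟩, ?_⟩
    rw [QuotientAddGroup.eq]
    exact AddSubgroup.mem_closure_singleton.2 ⟨⌊z.re⌋, by simp⟩
  | torus =>
    refine ⟨z - ⌊z.re⌋ - ⌊z.im⌋ * Complex.I, ⟨by simpa using h z.re, by simpa using h z.im⟩, ?_⟩
    rw [QuotientAddGroup.eq]
    exact AddSubgroup.mem_closure_pair.2 ⟨⌊z.re⌋, ⌊z.im⌋, by simp; ring⟩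

theorem dist_mk_le (z w : ℂ) : dist (z : ℂ ⧸ S.deck) w ≤ dist z w := by
  rw [dist_eq_norm, dist_eq_norm, ← QuotientAddGroup.mk_sub]
  exact QuotientAddGroup.norm_mk_le_norm

theorem dist_mk_lt_iff {z w : ℂ} {r : ℝ} :
    dist (z : ℂ ⧸ S.deck) w < r ↔ ∃ d ∈ S.deck, dist z (w + d) < r := by
  rw [dist_eq_norm, ← QuotientAddGroup.mk_sub, QuotientAddGroup.norm_lt_iff]
  constructor
  · rintro ⟨m, hm, hr⟩
    rw [eq_comm, QuotientAddGroup.eq] at hm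
    refine ⟨z - w - m, ?_, ?_⟩
    · simpa [sub_eq_add_neg, add_comm] using S.deck.neg_mem hm
    · rw [dist_eq_norm]; convert hr using 2; ring
  · rintro ⟨d, hd, hr⟩
    refine ⟨z - w - d, ?_, ?_⟩
    · rw [QuotientAddGroup.eq]; convert hd using 1; ring
    · rw [dist_eq_norm] at hr; convert hr using 2; ring

theorem continuous_proj : Continuous S.proj :=
  Continuous.subtype_mk (continuous_quotient_mk'.comp continuous_subtype_val) _

theorem proj_surjective : Function.Surjective S.proj := fun w => by
  obtain ⟨w, z, hz, rfl⟩ := w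
  exact ⟨⟨z, hz⟩, rfl⟩

theorem exists_cell_proj_eq (w : S.Pt) : ∃ z : S.domain, (z : ℂ) ∈ S.cell ∧ S.proj z = w := by
  obtain ⟨w, z, hz, rfl⟩ := w
  obtain ⟨c, hc, h⟩ := S.exists_mem_cell hz
  exact ⟨⟨c, S.cell_subset_domain hc⟩, hc, Subtype.ext h⟩

instance : CompactSpace S.Pt := by
  have hK : IsCompact ((↑) ⁻¹' S.cell : Set S.domain) :=
    S.isClosed_domain.isClosedEmbedding_subtypeVal.isCompact_preimage S.isCompact_cell
  refine ⟨?_⟩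
  have : S.proj '' ((↑) ⁻¹' S.cell) = univ :=
    eq_univ_of_forall fun w => by
      obtain ⟨z, hz, h⟩ := S.exists_cell_proj_eq w
      exact ⟨z, hz, h⟩
  rw [← this]
  exact hK.image S.continuous_proj

instance : T2Space S.Pt := by
  have := S.isClosed_deck
  exact inferInstanceAs (T2Space {w : ℂ ⧸ S.deck // ∃ z ∈ S.domain, (z : ℂ ⧸ S.deck) = w})

/-! ### The circle action -/

theorem dist_rotLift (t : ℝ) (z w : ℂ) : dist (S.rotLift t z) (S.rotLift t w) = dist z w := by
  cases S with
  | disc =>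
    have h : ‖Complex.exp (2 * Real.pi * t * Complex.I)‖ = 1 := by
      have := Complex.norm_exp_ofReal_mul_I (2 * Real.pi * t)
      push_cast at this
      exact this
    simp [rotLift, dist_eq_norm, ← mul_sub, h]
  | annulus => simp [rotLift]
  | torus => simp [rotLift]

/-- The lift is an isometry, and the quotient distance is an infimum over deck translates. A
constant independent of `t` is what bounds the covering numbers uniformly in time. -/
theorem lipschitzWith_rot (t : ℝ) : LipschitzWith 1 (S.rot t) := by
  refine LipschitzWith.of_dist_le_mul fun v w => ?_
  obtain ⟨z, rfl⟩ := S.proj_surjective v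
  obtain ⟨y, rfl⟩ := S.proj_surjective w
  rw [NNReal.coe_one, one_mul]
  refine le_of_forall_gt fun r hr => ?_
  obtain ⟨d, hd, h⟩ := S.dist_mk_lt_iff.1 hr
  have h2 : ((y : ℂ) : ℂ ⧸ S.deck) = ((y + d : ℂ) : ℂ ⧸ S.deck) := by
    rw [QuotientAddGroup.eq]; simpa using hd
  have h3 : ((S.rotLift t y : ℂ) : ℂ ⧸ S.deck) = (S.rotLift t (y + d) : ℂ) := by
    rw [← rotQuot_mk, h2, rotQuot_mk]
  calc dist (S.rot t (S.proj z)) (S.rot t (S.proj y))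
      = dist (S.rotLift t z : ℂ ⧸ S.deck) (S.rotLift t y : ℂ) := rfl
    _ ≤ dist (S.rotLift t z) (S.rotLift t (y + d)) := by rw [h3]; exact S.dist_mk_le _ _
    _ < r := by rwa [dist_rotLift]

theorem contDiff_rotLift : ContDiff ℝ ∞ fun q : ℝ × ℂ => S.rotLift q.1 q.2 := by
  have h : ContDiff ℝ ∞ fun q : ℝ × ℂ => (q.1 : ℂ) := Complex.ofRealCLM.contDiff.comp contDiff_fst
  cases S with
  | disc =>
    exact (Complex.contDiff_exp.comp ((contDiff_const.mul h).mul contDiff_const)).mul contDiff_snd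
  | annulus => exact h.add contDiff_snd
  | torus => exact h.add contDiff_snd

theorem rot_proj (t : ℝ) (z : S.domain) :
    S.rot t (S.proj z) = S.proj ⟨S.rotLift t z, S.rotLift_mem t z.2⟩ := rfl

theorem continuous_rot : Continuous fun q : ℝ × S.Pt => S.rot q.1 q.2 := by
  refine continuous_prod_of_continuous_lipschitzWith' _ 1 S.lipschitzWith_rot fun w => ?_
  obtain ⟨z, rfl⟩ := S.proj_surjective w
  simp only [rot_proj]
  exact S.continuous_proj.comp (Continuous.subtype_mk
    (S.contDiff_rotLift.continuous.comp (by fun_prop : Continuous fun t : ℝ => (t, (z : ℂ)))) _)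

theorem rot_rot (s t : ℝ) (w : S.Pt) : S.rot s (S.rot t w) = S.rot (s + t) w :=
  Subtype.ext (S.rotQuot_add s t w.1)

theorem rot_zero (w : S.Pt) : S.rot 0 w = w := Subtype.ext (S.rotQuot_zero w.1)

theorem rot_symm (t : ℝ) : (S.rot t).symm = S.rot (-t) := by
  ext1 w
  rfl

/-! ### The area -/

theorem measurable_proj : Measurable S.proj := S.continuous_proj.measurable

theorem area_apply {A : Set S.Pt} (hA : MeasurableSet A) :
    S.area A = volume (((↑) '' (S.proj ⁻¹' A)) ∩ S.cell) := by
  have hd : MeasurableSet S.domain := S.isClosed_domain.measurableSet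
  have h := S.measurable_proj hA
  rw [area, Measure.map_apply S.measurable_proj hA,
    (MeasurableEmbedding.subtype_coe hd).comap_apply,
    Measure.restrict_apply ((MeasurableEmbedding.subtype_coe hd).measurableSet_image.2 h)]

instance : IsFiniteMeasure S.area := by
  refine ⟨?_⟩
  rw [S.area_apply MeasurableSet.univ]
  exact (measure_mono inter_subset_right).trans_lt S.isCompact_cell.measure_lt_top

theorem isAddFundamentalDomain_strip (t : ℝ) :
    IsAddFundamentalDomain (AddSubgroup.zmultiples (1 : ℂ)) (Complex.re ⁻¹' Ioc t (t + 1)) := by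
  refine IsAddFundamentalDomain.mk'
    (Complex.measurable_re measurableSet_Ioc).nullMeasurableSet fun z => ?_
  have hinj : Function.Injective fun n : ℤ => n • (1 : ℂ) := fun m n h => by simpa using h
  have : Function.Bijective (codRestrict (fun n : ℤ => n • (1 : ℂ))
      (AddSubgroup.zmultiples (1 : ℂ)) fun n => ⟨n, rfl⟩) :=
    (Equiv.ofInjective _ hinj).bijective
  refine this.existsUnique_iff.2 ?_
  have h := existsUnique_add_zsmul_mem_Ioc one_pos z.re t
  convert h using 3 with n
  simp [AddSubgroup.vadd_def, add_comm]

theorem volume_re_eq_zero : volume {z : ℂ | z.re = 0} = 0 := by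
  have h := Measure.addHaar_submodule (volume : Measure ℂ) (LinearMap.ker Complex.reLm) fun h => by
    have : (1 : ℂ) ∈ LinearMap.ker Complex.reLm := h ▸ Submodule.mem_top
    simp at this
  exact h

/-- Half-open strips of width one are fundamental domains for the integer translations, so a
periodic set has the same area in each of them. The edge lost by passing to half-open strips is
null. -/
theorem volume_inter_strip_translate {A : Set ℂ} (hA : MeasurableSet A)
    (hper : ∀ (n : ℤ) (z : ℂ), n + z ∈ A ↔ z ∈ A) (t : ℝ) :
    volume (((fun z : ℂ => t + z) ⁻¹' A) ∩ Complex.re ⁻¹' Icc 0 1)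
      = volume (A ∩ Complex.re ⁻¹' Icc 0 1) := by
  have hIcc : ∀ B : Set ℂ, volume (B ∩ Complex.re ⁻¹' Icc 0 1)
      = volume (B ∩ Complex.re ⁻¹' Ioc 0 1) := fun B => by
    refine le_antisymm ?_ (measure_mono (inter_subset_inter_right _
      (preimage_mono Ioc_subset_Icc_self)))
    refine (measure_mono (t := (B ∩ Complex.re ⁻¹' Ioc 0 1) ∪ {z : ℂ | z.re = 0}) ?_).trans
      ((measure_union_le _ _).trans_eq (by rw [volume_re_eq_zero, add_zero]))
    rintro z ⟨hz, h0, h1⟩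
    rcases h0.eq_or_lt with h | h
    · exact Or.inr h.symm
    · exact Or.inl ⟨hz, h, h1⟩
  have hfd := (isAddFundamentalDomain_strip t).measure_set_eq
    (isAddFundamentalDomain_strip 0) hA fun g => by
      obtain ⟨_, n, rfl⟩ := g
      ext z
      simpa [AddSubgroup.vadd_def] using hper n z
  rw [zero_add] at hfd
  rw [hIcc, hIcc, ← hfd, ← measure_preimage_add volume (t : ℂ) (A ∩ _), preimage_inter]
  congr 2
  ext z
  simp [add_comm]

theorem volume_square_translate {A : Set ℂ} (hA : MeasurableSet A)
    (hper : ∀ (n : ℤ) (z : ℂ), n + z ∈ A ↔ z ∈ A) (t : ℝ) :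
    volume (((fun z : ℂ => t + z) ⁻¹' A) ∩
        {z | (0 ≤ z.re ∧ z.re ≤ 1) ∧ 0 ≤ z.im ∧ z.im ≤ 1})
      = volume (A ∩ {z | (0 ≤ z.re ∧ z.re ≤ 1) ∧ 0 ≤ z.im ∧ z.im ≤ 1}) := by
  have h := volume_inter_strip_translate (A := A ∩ Complex.im ⁻¹' Icc 0 1)
    (hA.inter (Complex.measurable_im measurableSet_Icc)) (fun n z => by simp [hper]) t
  convert h using 2
  · ext z; simp [and_assoc, and_comm, and_left_comm]
  · ext z; simp [and_assoc, and_comm, and_left_comm]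

theorem volume_disc_rotate (A : Set ℂ) (t : ℝ) :
    volume ((disc.rotLift t ⁻¹' A) ∩ Metric.closedBall 0 1)
      = volume (A ∩ Metric.closedBall 0 1) := by
  have h : ∀ z, disc.rotLift t z = rotation (Circle.exp (2 * Real.pi * t)) z := fun z => by
    simp [rotLift]
  have hb : disc.rotLift t ⁻¹' Metric.closedBall 0 1 = Metric.closedBall 0 1 := by
    ext z
    rw [mem_preimage, h, mem_closedBall_zero_iff, LinearIsometryEquiv.norm_map,
      mem_closedBall_zero_iff]
  have hm : MeasurePreserving (disc.rotLift t) := by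
    rw [funext h]
    exact LinearIsometryEquiv.measurePreserving _
  have he : MeasurableEmbedding (disc.rotLift t) := by
    rw [funext h]
    exact (rotation (Circle.exp (2 * Real.pi * t))).toHomeomorph.measurableEmbedding
  conv_lhs => rw [← hb, ← preimage_inter]
  exact hm.measure_preimage_emb he _

theorem measurePreserving_rot (t : ℝ) : MeasurePreserving (S.rot t) S.area S.area := by
  refine ⟨(S.rot t).continuous.measurable, Measure.ext fun A hA => ?_⟩
  have hd : MeasurableSet S.domain := S.isClosed_domain.measurableSet
  rw [Measure.map_apply (S.rot t).continuous.measurable hA, S.area_apply hA,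
    S.area_apply ((S.rot t).continuous.measurable hA)]
  have hm : MeasurableSet (((↑) : S.domain → ℂ) '' (S.proj ⁻¹' A)) :=
    (MeasurableEmbedding.subtype_coe hd).measurableSet_image.2 (S.measurable_proj hA)
  have hpre : ((↑) : S.domain → ℂ) '' (S.proj ⁻¹' (S.rot t ⁻¹' A))
      = S.rotLift t ⁻¹' (((↑) : S.domain → ℂ) '' (S.proj ⁻¹' A)) := by
    ext z
    constructor
    · rintro ⟨y, hy, rfl⟩
      exact ⟨⟨_, S.rotLift_mem t y.2⟩, hy, rfl⟩
    · rintro ⟨y, hy, h⟩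
      have hz : z ∈ S.domain := by
        have := S.rotLift_mem (-t) y.2
        rwa [h, rotLift_add, neg_add_cancel, rotLift_zero] at this
      refine ⟨⟨z, hz⟩, ?_, rfl⟩
      have : y = ⟨S.rotLift t z, S.rotLift_mem t hz⟩ := Subtype.ext h
      subst this
      exact hy
  -- The unit square is not invariant under horizontal translation; periodicity of the lifted set
  -- makes up for this.
  have hdeck : ∀ d ∈ S.deck, ∀ z, d + z ∈ ((↑) : S.domain → ℂ) '' (S.proj ⁻¹' A) ↔
      z ∈ ((↑) : S.domain → ℂ) '' (S.proj ⁻¹' A) := by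
    have key : ∀ d ∈ S.deck, ∀ z, z ∈ ((↑) : S.domain → ℂ) '' (S.proj ⁻¹' A) →
        d + z ∈ ((↑) : S.domain → ℂ) '' (S.proj ⁻¹' A) := by
      rintro d hd _ ⟨y, hy, rfl⟩
      refine ⟨⟨d + y, add_comm (y : ℂ) d ▸ S.add_mem_domain y.2 hd⟩, ?_, rfl⟩
      have : S.proj ⟨d + y, add_comm (y : ℂ) d ▸ S.add_mem_domain y.2 hd⟩ = S.proj y :=
        Subtype.ext (QuotientAddGroup.eq.2 (by simpa using hd))
      rwa [mem_preimage, this]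
    exact fun d hd z => ⟨fun h => by simpa using key (-d) (S.deck.neg_mem hd) _ h, key d hd z⟩
  rw [hpre]
  cases S with
  | disc => exact volume_disc_rotate _ t
  | annulus =>
    refine volume_square_translate hm (fun n z => hdeck n ?_ z) t
    exact AddSubgroup.mem_closure_singleton.2 ⟨n, by simp⟩
  | torus =>
    refine volume_square_translate hm (fun n z => hdeck n ?_ z) t
    exact AddSubgroup.mem_closure_pair.2 ⟨n, 0, by simp⟩

end Surface

/-! ### Limits in the space of diffeomorphisms -/

theorem dist_le_of_le_geometric {X : Type*} [PseudoMetricSpace X] {u : ℕ → X} {N : ℕ}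
    (h : ∀ n ≥ N, dist (u n) (u (n + 1)) ≤ (1 / 2) ^ n) {n : ℕ} (hn : N ≤ n) :
    dist (u N) (u n) ≤ 2 * (1 / 2) ^ N := by
  obtain ⟨k, rfl⟩ := Nat.exists_eq_add_of_le hn
  have := dist_le_range_sum_of_dist_le (f := fun i => u (N + i)) (d := fun i => (1 / 2) ^ (N + i)) k
    fun {i} _ => h (N + i) (by omega)
  refine this.trans ?_
  simp only [pow_add]
  rw [← Finset.mul_sum, mul_comm]
  gcongr
  exact sum_geometric_two_le k

theorem uniformCauchySeqOn_of_le_geometric {X α : Type*} [PseudoMetricSpace X] {u : ℕ → α → X}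
    {s : Set α} (h : ∀ᶠ n in atTop, ∀ x ∈ s, dist (u n x) (u (n + 1) x) ≤ (1 / 2) ^ n) :
    UniformCauchySeqOn u atTop s := by
  rw [Metric.uniformCauchySeqOn_iff]
  intro δ hδ
  obtain ⟨N₀, hN₀⟩ := eventually_atTop.1 h
  obtain ⟨N₁, hN₁⟩ := exists_pow_lt_of_lt_one (show 0 < δ / 4 by positivity)
    (show (1 / 2 : ℝ) < 1 by norm_num)
  refine ⟨max N₀ N₁, fun m hm n hn x hx => ?_⟩
  have hgeo : ∀ k ≥ max N₀ N₁, dist (u k x) (u (k + 1) x) ≤ (1 / 2) ^ k := fun k hk =>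
    hN₀ k (le_of_max_le_left hk) x hx
  have h1 := dist_le_of_le_geometric (u := fun n => u n x) hgeo hm
  have h2 := dist_le_of_le_geometric (u := fun n => u n x) hgeo hn
  have h3 : (1 / 2 : ℝ) ^ max N₀ N₁ ≤ (1 / 2) ^ N₁ :=
    pow_le_pow_of_le_one (by norm_num) (by norm_num) (le_max_right _ _)
  linarith [dist_triangle_left (u m x) (u n x) (u (max N₀ N₁) x)]

/-- Integrals of bounded continuous functions determine a finite measure, and they pass to the limit
by dominated convergence. -/
theorem MeasureTheory.MeasurePreserving.of_tendsto {X : Type*} [PseudoMetricSpace X]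
    [MeasurableSpace X] [BorelSpace X] {μ : Measure X} [IsFiniteMeasure μ] {f : ℕ → X → X}
    {g : X → X} (hf : ∀ n, MeasurePreserving (f n) μ μ) (hg : Measurable g)
    (h : ∀ x, Tendsto (fun n => f n x) atTop (𝓝 (g x))) : MeasurePreserving g μ μ := by
  refine ⟨hg, ext_of_forall_integral_eq_of_IsFiniteMeasure fun φ => ?_⟩
  rw [integral_map hg.aemeasurable φ.continuous.aestronglyMeasurable]
  have h1 : Tendsto (fun n => ∫ x, φ (f n x) ∂μ) atTop (𝓝 (∫ x, φ (g x) ∂μ)) := by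
    refine tendsto_integral_of_dominated_convergence (fun _ => ‖φ‖)
      (fun n => (φ.continuous.measurable.comp (hf n).measurable).aestronglyMeasurable)
      (integrable_const _) (fun n => Eventually.of_forall fun x => φ.norm_coe_le_norm _)
      (Eventually.of_forall fun x => (φ.continuous.tendsto _).comp (h x))
  have h2 : ∀ n, ∫ x, φ (f n x) ∂μ = ∫ x, φ x ∂μ := fun n => by
    conv_rhs => rw [← (hf n).map_eq]
    rw [integral_map (hf n).measurable.aemeasurable φ.continuous.aestronglyMeasurable]
  simp only [h2] at h1
  exact tendsto_nhds_unique h1 tendsto_const_nhds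

namespace Surface

variable {S : Surface}

/-- The domain is invariant under deck translations, so a map that projects to `f` cannot leave it.
-/
theorem IsLift.of_proj_eq {f : S.Pt ≃ₜ S.Pt} {F : ℂ → ℂ} (hc : ContinuousOn F S.domain)
    (h : ∀ z : S.domain, (f (S.proj z)).1 = (F z : ℂ ⧸ S.deck)) : IsLift f F := by
  refine ⟨hc, fun z hz => ?_, h⟩
  obtain ⟨y, hy, hyz⟩ := (f (S.proj ⟨z, hz⟩)).2
  rw [h ⟨z, hz⟩, QuotientAddGroup.eq] at hyz
  simpa using S.add_mem_domain hy hyz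

theorem IsLift.apply_proj {f : S.Pt ≃ₜ S.Pt} {F : ℂ → ℂ} (hF : IsLift f F) (z : S.domain) :
    f (S.proj z) = S.proj ⟨F z, hF.mapsTo z.2⟩ :=
  Subtype.ext (hF.proj_eq z)

theorem IsLift.trans {f g : S.Pt ≃ₜ S.Pt} {F G : ℂ → ℂ} (hF : IsLift f F) (hG : IsLift g G) :
    IsLift (f.trans g) (G ∘ F) where
  continuousOn := hG.continuousOn.comp hF.continuousOn hF.mapsTo
  mapsTo := hG.mapsTo.comp hF.mapsTo
  proj_eq z := by
    rw [Homeomorph.trans_apply, hF.apply_proj, hG.proj_eq]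
    rfl

theorem isLift_refl : IsLift (Homeomorph.refl S.Pt) id :=
  .of_proj_eq continuousOn_id fun _ => rfl

theorem isLift_rot (t : ℝ) : IsLift (S.rot t) (S.rotLift t) :=
  .of_proj_eq (S.continuous_rotLift t).continuousOn fun _ => rfl

theorem IsSmoothDiffeo.refl : IsSmoothDiffeo (Homeomorph.refl S.Pt) where
  smooth := ⟨id, isLift_refl, contDiffOn_id⟩
  smooth_symm := ⟨id, isLift_refl, contDiffOn_id⟩
  measurePreserving := MeasurePreserving.id _

theorem IsSmoothDiffeo.symm {f : S.Pt ≃ₜ S.Pt} (hf : IsSmoothDiffeo f) : IsSmoothDiffeo f.symm where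
  smooth := hf.smooth_symm
  smooth_symm := hf.smooth
  measurePreserving := hf.measurePreserving.symm f.toMeasurableEquiv

theorem IsSmoothDiffeo.trans {f g : S.Pt ≃ₜ S.Pt} (hf : IsSmoothDiffeo f) (hg : IsSmoothDiffeo g) :
    IsSmoothDiffeo (f.trans g) where
  smooth := by
    obtain ⟨F, hF, hF'⟩ := hf.smooth
    obtain ⟨G, hG, hG'⟩ := hg.smooth
    exact ⟨_, hF.trans hG, hG'.comp hF' hF.mapsTo⟩
  smooth_symm := by
    obtain ⟨F, hF, hF'⟩ := hf.smooth_symm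
    obtain ⟨G, hG, hG'⟩ := hg.smooth_symm
    exact ⟨_, hG.trans hF, hF'.comp hG' hG.mapsTo⟩
  measurePreserving := hg.measurePreserving.comp hf.measurePreserving

theorem contDiff_rotLift_right (t : ℝ) : ContDiff ℝ ∞ (S.rotLift t) :=
  S.contDiff_rotLift.comp (contDiff_const.prodMk contDiff_id)

theorem IsSmoothDiffeo.rot (t : ℝ) : IsSmoothDiffeo (S.rot t) where
  smooth := ⟨_, isLift_rot t, (contDiff_rotLift_right t).contDiffOn⟩
  smooth_symm := ⟨_, S.rot_symm t ▸ isLift_rot (-t), (contDiff_rotLift_right (-t)).contDiffOn⟩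
  measurePreserving := S.measurePreserving_rot t

theorem liftNorm_le {k : ℕ} {F : ℂ → ℂ} {C : ℝ}
    (h : ∀ j ≤ k, ∀ z ∈ S.cell, ‖iteratedFDerivWithin ℝ j F S.domain z‖ ≤ C) :
    liftNorm S k F ≤ ENNReal.ofReal C := by
  refine iSup₂_le fun j hj => iSup_le fun s => iSup₂_le fun z hz => ENNReal.ofReal_le_ofReal ?_
  have h1 : ‖partialDeriv S F s z‖ ≤ C := by
    refine (ContinuousMultilinearMap.le_opNorm _ _).trans ?_
    rw [Finset.prod_eq_one, mul_one]
    · exact h j hj z hz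
    · intro i _
      generalize s i = a
      fin_cases a <;> simp
  exact max_le ((Complex.abs_re_le_norm _).trans h1) ((Complex.abs_im_le_norm _).trans h1)

theorem semiDist_le {k : ℕ} {f g : S.Pt ≃ₜ S.Pt} {F G : ℂ → ℂ} (hF : IsLift f F) (hG : IsLift g G) :
    semiDist k f g ≤ liftNorm S k (fun z => F z - G z) :=
  iInf₂_le_of_le F hF (iInf₂_le G hG)

/-- `g` is obtained from `f` by adding `D` in the universal cover. -/
structure IsPerturbation (f g : S.Pt ≃ₜ S.Pt) (D : ℂ → ℂ) : Prop where
  contDiffOn : ContDiffOn ℝ ∞ D S.domain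
  proj_eq : ∀ z : S.domain, (g (S.proj z)).1 = (f (S.proj z)).1 + (D z : ℂ ⧸ S.deck)

theorem IsPerturbation.isLift {f g : S.Pt ≃ₜ S.Pt} {D F : ℂ → ℂ} (h : IsPerturbation f g D)
    (hF : IsLift f F) : IsLift g (fun z => F z + D z) :=
  .of_proj_eq (hF.continuousOn.add h.contDiffOn.continuousOn) fun z => by
    rw [h.proj_eq, hF.proj_eq, QuotientAddGroup.mk_add]

theorem IsPerturbation.semiDist_le {f g : S.Pt ≃ₜ S.Pt} {D : ℂ → ℂ} (h : IsPerturbation f g D)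
    (hf : IsSmoothDiffeo f) {k : ℕ} {C : ℝ}
    (hC : ∀ j ≤ k, ∀ z ∈ S.cell, ‖iteratedFDerivWithin ℝ j D S.domain z‖ ≤ C) :
    semiDist k f g ≤ ENNReal.ofReal C := by
  obtain ⟨F, hF, -⟩ := hf.smooth
  refine (Surface.semiDist_le hF (h.isLift hF)).trans (liftNorm_le fun j hj z hz => ?_)
  have : (fun z => F z - (F z + D z)) = -D := by ext1 z; simp
  rw [this, iteratedFDerivWithin_neg_apply S.uniqueDiffOn_domain (S.cell_subset_domain hz),
    norm_neg]
  exact hC j hj z hz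

/-- Perturbations which decrease geometrically, together with all derivatives on bounded sets. -/
def IsGeometric (S : Surface) (D : ℕ → ℂ → ℂ) : Prop :=
  ∀ n : ℕ, ∀ j ≤ n, ∀ z ∈ S.domain ∩ Metric.closedBall 0 (n + 2),
    ‖iteratedFDerivWithin ℝ j (D n) S.domain z‖ ≤ (1 / 2) ^ n

/-- One lift of `f 0` is fixed and the `D n` are added successively. The lifts are thus compatible,
with no deck translation to correct, and their derivatives are Cauchy on every ball because the
radii `n + 2` exhaust the plane. -/
theorem exists_lift_limit {f : ℕ → S.Pt ≃ₜ S.Pt} {D : ℕ → ℂ → ℂ} (hf : IsSmoothDiffeo (f 0))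
    (hD : ∀ n, IsPerturbation (f n) (f (n + 1)) (D n)) (hgeo : IsGeometric S D) :
    ∃ (F : ℕ → ℂ → ℂ) (G : ℂ → ℂ), (∀ n, IsLift (f n) (F n) ∧ ContDiffOn ℝ ∞ (F n) S.domain) ∧
      ContDiffOn ℝ ∞ G S.domain ∧ ∀ (j : ℕ) (r : ℝ),
        TendstoUniformlyOn (fun n => iteratedFDerivWithin ℝ j (F n) S.domain)
          (iteratedFDerivWithin ℝ j G S.domain) atTop (S.domain ∩ Metric.closedBall 0 r) := by
  obtain ⟨F₀, hF₀, hF₀'⟩ := hf.smooth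
  let F : ℕ → ℂ → ℂ := fun n => Nat.rec F₀ (fun n Φ => Φ + D n) n
  have hF : ∀ n, IsLift (f n) (F n) ∧ ContDiffOn ℝ ∞ (F n) S.domain := fun n => by
    induction n with
    | zero => exact ⟨hF₀, hF₀'⟩
    | succ n ih => exact ⟨(hD n).isLift ih.1, ih.2.add (hD n).contDiffOn⟩
  obtain ⟨G, hG⟩ := exists_contDiffOn_limit S.convex_domain S.uniqueDiffOn_domain
    (fun n => (hF n).2) fun j r => uniformCauchySeqOn_of_le_geometric (by
      filter_upwards [eventually_ge_atTop j, eventually_ge_atTop ⌈r⌉₊] with n hj hr z hz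
      have hr' : r ≤ n + 2 := by
        have : (⌈r⌉₊ : ℝ) ≤ n := by exact_mod_cast hr
        linarith [Nat.le_ceil r]
      have : iteratedFDerivWithin ℝ j (F (n + 1)) S.domain z
          = iteratedFDerivWithin ℝ j (F n) S.domain z
            + iteratedFDerivWithin ℝ j (D n) S.domain z :=
        iteratedFDerivWithin_add_apply (((hF n).2 z hz.1).of_le (by exact_mod_cast le_top))
          (((hD n).contDiffOn z hz.1).of_le (by exact_mod_cast le_top)) S.uniqueDiffOn_domain hz.1
      rw [this, dist_self_add_right]
      exact hgeo n j hj z ⟨hz.1, Metric.closedBall_subset_closedBall hr' hz.2⟩)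
  exact ⟨F, G, hF, hG⟩

theorem exists_tendstoUniformly {f : ℕ → S.Pt ≃ₜ S.Pt} {F : ℕ → ℂ → ℂ} {G : ℂ → ℂ}
    (hF : ∀ n, IsLift (f n) (F n))
    (hG : ∀ r, TendstoUniformlyOn (fun n => iteratedFDerivWithin ℝ 0 (F n) S.domain)
      (iteratedFDerivWithin ℝ 0 G S.domain) atTop (S.domain ∩ Metric.closedBall 0 r)) :
    ∃ g : S.Pt → S.Pt, (∀ z : S.domain, (g (S.proj z)).1 = (G z : ℂ ⧸ S.deck)) ∧
      TendstoUniformly (fun n => f n) g atTop := by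
  have hG' : ∀ r, TendstoUniformlyOn F G atTop (S.domain ∩ Metric.closedBall 0 r) := fun r => by
    have := hG r
    simp only [Metric.tendstoUniformlyOn_iff, iteratedFDerivWithin_zero_eq_comp,
      Function.comp_apply, LinearIsometryEquiv.dist_map] at this ⊢
    exact this
  have hGd : MapsTo G S.domain S.domain := fun z hz =>
    S.isClosed_domain.mem_of_tendsto ((hG' ‖z‖).tendsto_at ⟨hz, by simp⟩)
      (Eventually.of_forall fun n => (hF n).mapsTo hz)
  have hpt : ∀ z : S.domain, Tendsto (fun n => f n (S.proj z)) atTop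
      (𝓝 (S.proj ⟨G z, hGd z.2⟩)) := fun z => by
    simp only [(hF _).apply_proj]
    refine (S.continuous_proj.tendsto _).comp (tendsto_subtype_rng.2 ?_)
    exact (hG' ‖(z : ℂ)‖).tendsto_at ⟨z.2, by simp⟩
  -- The limit is defined through representatives in the bounded cell, which makes convergence
  -- uniform on the surface. Uniqueness of limits shows independence of the representative.
  choose rep hcell hrep using S.exists_cell_proj_eq
  refine ⟨fun w => S.proj ⟨G (rep w), hGd (rep w).2⟩, fun z => ?_, ?_⟩
  · have h := hpt (rep (S.proj z))
    rw [hrep] at h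
    have h' : S.proj ⟨G (rep (S.proj z)), _⟩ = S.proj ⟨G z, _⟩ := tendsto_nhds_unique h (hpt z)
    exact congrArg (fun w : S.Pt => w.1) h'
  · rw [Metric.tendstoUniformly_iff]
    intro δ hδ
    filter_upwards [Metric.tendstoUniformlyOn_iff.1 (hG' 2) δ hδ] with n hn w
    have h := hn (rep w) ⟨(rep w).2, S.cell_subset_closedBall (hcell w)⟩
    have hw : f n w = S.proj ⟨F n (rep w), (hF n).mapsTo (rep w).2⟩ := by
      rw [← (hF n).apply_proj, hrep]
    rw [hw]
    exact (S.dist_mk_le _ _).trans_lt h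

theorem tendsto_semiDist {f : ℕ → S.Pt ≃ₜ S.Pt} {T : S.Pt ≃ₜ S.Pt} {F : ℕ → ℂ → ℂ} {G : ℂ → ℂ}
    (hF : ∀ n, IsLift (f n) (F n) ∧ ContDiffOn ℝ ∞ (F n) S.domain) (hT : IsLift T G)
    (hGs : ContDiffOn ℝ ∞ G S.domain)
    (hG : ∀ (j : ℕ) (r : ℝ), TendstoUniformlyOn
      (fun n => iteratedFDerivWithin ℝ j (F n) S.domain)
      (iteratedFDerivWithin ℝ j G S.domain) atTop (S.domain ∩ Metric.closedBall 0 r)) (k : ℕ) :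
    Tendsto (fun n => semiDist k (f n) T) atTop (𝓝 0) := by
  rw [ENNReal.tendsto_nhds_zero]
  intro δ hδ
  obtain ⟨r, hr0, hr⟩ := ENNReal.lt_iff_exists_nnreal_btwn.1 hδ
  have hr0' : (0 : ℝ) < r := by exact_mod_cast hr0
  have h : ∀ᶠ n in atTop, ∀ j ∈ Finset.range (k + 1), ∀ z ∈ S.domain ∩ Metric.closedBall 0 2,
      dist (iteratedFDerivWithin ℝ j G S.domain z)
        (iteratedFDerivWithin ℝ j (F n) S.domain z) < r :=
    (Finset.eventually_all _).2 fun j _ => Metric.tendstoUniformlyOn_iff.1 (hG j 2) r hr0'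
  filter_upwards [h] with n hn
  refine (semiDist_le (hF n).1 hT).trans ((liftNorm_le (C := r) fun j hj z hz => ?_).trans
    (by rw [ENNReal.ofReal_coe_nnreal]; exact hr.le))
  have hz' := S.cell_subset_domain hz
  rw [fun_iteratedFDerivWithin_sub_apply (((hF n).2 z hz').of_le (by exact_mod_cast le_top))
    ((hGs z hz').of_le (by exact_mod_cast le_top)) S.uniqueDiffOn_domain hz', ← dist_eq_norm,
    dist_comm]
  exact (hn j (Finset.mem_range.2 (by omega)) z ⟨hz', S.cell_subset_closedBall hz⟩).le

theorem rightInverse_of_tendstoUniformly {X : Type*} [PseudoMetricSpace X] [T2Space X]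
    {f : ℕ → X ≃ₜ X} {g g' : X → X} (hg : TendstoUniformly (fun n => f n) g atTop)
    (hg' : TendstoUniformly (fun n => (f n).symm) g' atTop) : Function.RightInverse g' g := by
  intro w
  have hc : Continuous g := hg.continuous (Frequently.of_forall fun n => (f n).continuous)
  have h := hg.tendsto_comp hc.continuousAt (hg'.tendsto_at w)
  simp only [Homeomorph.apply_symm_apply] at h
  exact tendsto_nhds_unique h tendsto_const_nhds

/-- The maps and their inverses converge separately; by uniform convergence the two limits are
inverse to each other. -/
theorem exists_limit {f : ℕ → S.Pt ≃ₜ S.Pt} {D E : ℕ → ℂ → ℂ} (hf : ∀ n, IsSmoothDiffeo (f n))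
    (hD : ∀ n, IsPerturbation (f n) (f (n + 1)) (D n)) (hDgeo : IsGeometric S D)
    (hE : ∀ n, IsPerturbation (f n).symm (f (n + 1)).symm (E n)) (hEgeo : IsGeometric S E) :
    ∃ T : S.Pt ≃ₜ S.Pt, IsSmoothDiffeo T ∧
      (∀ k, Tendsto (fun n => diffDist k (f n) T) atTop (𝓝 0)) ∧
      TendstoUniformly (fun n => f n) T atTop := by
  obtain ⟨F, G, hF, hGs, hG⟩ := exists_lift_limit (hf 0) hD hDgeo
  obtain ⟨F', G', hF', hGs', hG'⟩ := exists_lift_limit (f := fun n => (f n).symm) (hf 0).symm hE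
    hEgeo
  obtain ⟨g, hg, hlim⟩ := exists_tendstoUniformly (fun n => (hF n).1) (hG 0)
  obtain ⟨g', hg', hlim'⟩ := exists_tendstoUniformly (fun n => (hF' n).1) (hG' 0)
  let T : S.Pt ≃ₜ S.Pt :=
    { toFun := g
      invFun := g'
      left_inv := rightInverse_of_tendstoUniformly (f := fun n => (f n).symm) hlim' hlim
      right_inv := rightInverse_of_tendstoUniformly hlim hlim'
      continuous_toFun := hlim.continuous (Frequently.of_forall fun n => (f n).continuous)
      continuous_invFun := hlim'.continuous
        (Frequently.of_forall fun n => (f n).symm.continuous) }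
  have hT : IsLift T G := .of_proj_eq hGs.continuousOn hg
  have hT' : IsLift T.symm G' := .of_proj_eq hGs'.continuousOn hg'
  refine ⟨T, ⟨⟨G, hT, hGs⟩, ⟨G', hT', hGs'⟩, ?_⟩, fun k => ?_, hlim⟩
  · exact .of_tendsto (fun n => (hf n).measurePreserving) T.continuous.measurable
      fun w => hlim.tendsto_at w
  · simpa [diffDist] using
      (tendsto_semiDist hF hT hGs hG k).max (tendsto_semiDist hF' hT' hGs' hG' k)

end Surface

/-! ### Conjugates of the circle action -/

namespace Surface

variable {S : Surface}

/-- The conjugate `H ∘ R_t ∘ H⁻¹`. -/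
noncomputable def rotConj (H : S.Pt ≃ₜ S.Pt) (t : ℝ) : S.Pt ≃ₜ S.Pt := (H.symm.trans (S.rot t)).trans H

theorem rotConj_apply (H : S.Pt ≃ₜ S.Pt) (t : ℝ) (w : S.Pt) :
    rotConj H t w = H (S.rot t (H.symm w)) := rfl

theorem rotConj_symm (H : S.Pt ≃ₜ S.Pt) (t : ℝ) : (rotConj H t).symm = rotConj H (-t) := by
  ext1 w
  rfl

theorem iterate_rotConj (H : S.Pt ≃ₜ S.Pt) (t : ℝ) (i : ℕ) (w : S.Pt) :
    (rotConj H t)^[i] w = H (S.rot (i * t) (H.symm w)) := by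
  induction i with
  | zero => simp [rot_zero]
  | succ i ih =>
    rw [Function.iterate_succ_apply', ih, rotConj_apply, Homeomorph.symm_apply_apply, rot_rot]
    congr 3
    push_cast
    ring

theorem IsSmoothDiffeo.rotConj {H : S.Pt ≃ₜ S.Pt} (hH : IsSmoothDiffeo H) (t : ℝ) :
    IsSmoothDiffeo (rotConj H t) :=
  (hH.symm.trans (.rot t)).trans hH

/-- A finite set which is dense at a given scale for all conjugated rotations at once. -/
theorem exists_finset_rotConj (H : S.Pt ≃ₜ S.Pt) {δ : ℝ} (hδ : 0 < δ) :
    ∃ C : Finset S.Pt, ∀ y, ∃ x ∈ C, ∀ t, dist (rotConj H t x) (rotConj H t y) < δ := by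
  classical
  -- The net is the `H`-image of an `η`-net: `R_t` does not increase the distance `η`, and uniform
  -- continuity of `H` turns it into `δ`, whatever `t` is.
  obtain ⟨η, hη, h⟩ := Metric.uniformContinuous_iff.1
    (CompactSpace.uniformContinuous_of_continuous H.continuous) δ hδ
  obtain ⟨C, -, hC, hcover⟩ := finite_cover_balls_of_compact (isCompact_univ (X := S.Pt)) hη
  refine ⟨hC.toFinset.image H, fun y => ?_⟩
  obtain ⟨x, hx, hxy⟩ := mem_iUnion₂.1 (hcover (mem_univ (H.symm y)))
  refine ⟨H x, Finset.mem_image_of_mem _ (hC.mem_toFinset.2 hx), fun t => ?_⟩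
  rw [rotConj_apply, rotConj_apply, Homeomorph.symm_apply_apply]
  refine h (lt_of_le_of_lt ?_ (Metric.mem_ball'.1 hxy))
  simpa using (S.lipschitzWith_rot t).dist_le_mul x (H.symm y)

/-- Iterates are conjugates of `R_{iβ}`, jointly continuous in `β` and the point. Compactness of the
surface and finiteness of the time range give uniformity. -/
theorem eventually_dist_iterate_rotConj (H : S.Pt ≃ₜ S.Pt) (α : ℝ) (M : ℕ) {δ : ℝ} (hδ : 0 < δ) :
    ∀ᶠ β in 𝓝 α, ∀ i ≤ M, ∀ w, dist ((rotConj H α)^[i] w) ((rotConj H β)^[i] w) < δ := by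
  have h : ∀ᶠ β in 𝓝 α, ∀ i ∈ Finset.range (M + 1), ∀ w ∈ univ,
      dist (H (S.rot (i * α) (H.symm w))) (H (S.rot (i * β) (H.symm w))) < δ := by
    refine (Finset.eventually_all _).2 fun i _ =>
      isCompact_univ.eventually_forall_of_forall_eventually fun w _ => ?_
    have h1 : Continuous fun q : ℝ × S.Pt => H (S.rot (i * q.1) (H.symm q.2)) :=
      H.continuous.comp (S.continuous_rot.comp ((continuous_const.mul continuous_fst).prodMk
        (H.symm.continuous.comp continuous_snd)))
    have h2 : Continuous fun q : ℝ × S.Pt => dist (H (S.rot (i * α) (H.symm q.2)))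
        (H (S.rot (i * q.1) (H.symm q.2))) :=
      (h1.comp (continuous_const.prodMk continuous_snd)).dist h1
    exact h2.continuousAt.eventually_lt continuousAt_const (by simpa using hδ)
  filter_upwards [h] with β hβ i hi w
  rw [iterate_rotConj, iterate_rotConj]
  exact hβ i (Finset.mem_range.2 (by omega)) w (mem_univ w)

theorem eventually_isPerturbation_rotConj {H : S.Pt ≃ₜ S.Pt} (hH : IsSmoothDiffeo H) (α : ℝ)
    (N : ℕ) (r : ℝ) {δ : ℝ} (hδ : 0 < δ) :
    ∀ᶠ β in 𝓝 α, ∃ D, IsPerturbation (rotConj H α) (rotConj H β) D ∧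
      ∀ j ≤ N, ∀ z ∈ S.domain ∩ Metric.closedBall 0 r,
        ‖iteratedFDerivWithin ℝ j D S.domain z‖ ≤ δ := by
  obtain ⟨F, hF, hFs⟩ := hH.smooth
  obtain ⟨G, hG, hGs⟩ := hH.smooth_symm
  have hlift : ∀ t, IsLift (rotConj H t) (fun z => F (S.rotLift t (G z))) := fun t =>
    (hG.trans (isLift_rot t)).trans hF
  have hΦ : ContDiffOn ℝ ∞ (fun q : ℝ × ℂ => F (S.rotLift q.1 (G q.2))) (univ ×ˢ S.domain) := by
    refine hFs.comp (S.contDiff_rotLift.comp_contDiffOn (contDiff_fst.contDiffOn.prodMk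
      (hGs.comp contDiff_snd.contDiffOn fun q hq => hq.2))) fun q hq => ?_
    exact S.rotLift_mem _ (hG.mapsTo hq.2)
  have hs : ∀ t, ContDiffOn ℝ ∞ (fun z => F (S.rotLift t (G z))) S.domain := fun t =>
    hΦ.comp (f := fun z => (t, z)) (by fun_prop) fun z hz => ⟨mem_univ _, hz⟩
  have h : ∀ᶠ β in 𝓝 α, ∀ j ∈ Finset.range (N + 1), ∀ z ∈ S.domain ∩ Metric.closedBall 0 r,
      ‖iteratedFDerivWithin ℝ j (fun z => F (S.rotLift β (G z)) - F (S.rotLift α (G z)))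
        S.domain z‖ < δ :=
    (Finset.eventually_all _).2 fun j _ =>
      ContDiffOn.eventually_norm_iteratedFDerivWithin_sub_lt
        (f := fun t z => F (S.rotLift t (G z))) S.uniqueDiffOn_domain hΦ
        ((isCompact_closedBall _ _).inter_left S.isClosed_domain) inter_subset_left j α hδ
  filter_upwards [h] with β hβ
  refine ⟨_, ⟨(hs β).sub (hs α), fun z => ?_⟩,
    fun j hj z hz => (hβ j (Finset.mem_range.2 (by omega)) z hz).le⟩
  rw [(hlift α).proj_eq, (hlift β).proj_eq, ← QuotientAddGroup.mk_add]
  simp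

end Surface

/-! ### One stage of the construction -/

namespace AbC

open Surface

variable {S : Surface} {p₀ : ℤ} {q₀ : ℕ}

theorem ValidHistory.den_pos {w : List (Stage S)} (hw : ValidHistory p₀ q₀ w) (hq : 0 < q₀) :
    0 < den q₀ w := by
  induction w with
  | nil => exact hq
  | cons s w ih =>
    have := ih hw.1
    have := hw.2.1
    have := hw.2.2.k_pos
    simp only [den]
    positivity

theorem ValidHistory.isSmoothDiffeo_conj {w : List (Stage S)} (hw : ValidHistory p₀ q₀ w) :
    IsSmoothDiffeo (conj w) := by
  induction w with
  | nil => exact .refl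
  | cons s w ih => exact hw.2.2.diffeo.trans (ih hw.1)

theorem approx_eq_rotConj (w : List (Stage S)) :
    approx p₀ q₀ w = rotConj (conj w) (alpha p₀ q₀ w) := rfl

/-- Conjugation by `h` leaves `R_α` unchanged. Hence the approximations before and after a stage are
conjugated by the same map and differ in the angle only. -/
theorem approx_eq_rotConj_of_allowed {w : List (Stage S)} {k : ℕ} {h : S.Pt ≃ₜ S.Pt}
    (hh : Allowed p₀ q₀ w k h) :
    approx p₀ q₀ w = rotConj (h.trans (conj w)) (alpha p₀ q₀ w) := by
  ext1 x
  rw [approx_eq_rotConj, rotConj_apply, rotConj_apply]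
  simp [Homeomorph.symm_trans_apply, hh.comm]

theorem alpha_cons {w : List (Stage S)} (hw : ValidHistory p₀ q₀ w) (hq : 0 < q₀) {s : Stage S}
    (hk : 0 < s.k) (hl : 0 < s.l) :
    alpha p₀ q₀ (s :: w) = alpha p₀ q₀ w + 1 / (s.k * s.l * (den q₀ w : ℝ) ^ 2) := by
  have : (den q₀ w : ℝ) ≠ 0 := by exact_mod_cast (hw.den_pos hq).ne'
  have : (s.k : ℝ) ≠ 0 := by exact_mod_cast hk.ne'
  have : (s.l : ℝ) ≠ 0 := by exact_mod_cast hl.ne'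
  simp only [alpha, num, den]
  push_cast
  field_simp

theorem tendsto_alpha_cons {w : List (Stage S)} (hw : ValidHistory p₀ q₀ w) (hq : 0 < q₀) {k : ℕ}
    (hk : 0 < k) (h : S.Pt ≃ₜ S.Pt) :
    Tendsto (fun l => alpha p₀ q₀ (⟨k, l, h⟩ :: w)) atTop (𝓝 (alpha p₀ q₀ w)) := by
  have hd : (0 : ℝ) < den q₀ w := by exact_mod_cast hw.den_pos hq
  have hk' : (0 : ℝ) < k := by exact_mod_cast hk
  have h1 : Tendsto (fun l : ℕ => (k * l * (den q₀ w : ℝ) ^ 2)) atTop atTop :=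
    (tendsto_natCast_atTop_atTop.const_mul_atTop hk').atTop_mul_const (by positivity)
  have h2 := (h1.const_div_atTop 1).const_add (alpha p₀ q₀ w)
  rw [add_zero] at h2
  refine h2.congr' ?_
  filter_upwards [eventually_gt_atTop 0] with l hl
  rw [alpha_cons hw hq hk hl]

/-- The passage from `f` to `g` is a perturbation of size `δ`, for derivatives of order at most `N`
on the ball of radius `r`, and for the orbits up to time `M`. -/
structure IsCloseStep (f g : S.Pt ≃ₜ S.Pt) (N : ℕ) (r δ : ℝ) (M : ℕ) (D E : ℂ → ℂ) : Prop where
  pert : IsPerturbation f g D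
  pert_symm : IsPerturbation f.symm g.symm E
  norm_le : ∀ j ≤ N, ∀ z ∈ S.domain ∩ Metric.closedBall 0 r,
    ‖iteratedFDerivWithin ℝ j D S.domain z‖ ≤ δ
  norm_symm_le : ∀ j ≤ N, ∀ z ∈ S.domain ∩ Metric.closedBall 0 r,
    ‖iteratedFDerivWithin ℝ j E S.domain z‖ ≤ δ
  dist_iterate_le : ∀ i ≤ M, ∀ x, dist (f^[i] x) (g^[i] x) ≤ δ

theorem exists_isCloseStep {w : List (Stage S)} (hw : ValidHistory p₀ q₀ w) (hq : 0 < q₀) {k : ℕ}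
    {h : S.Pt ≃ₜ S.Pt} (hh : Allowed p₀ q₀ w k h) (N : ℕ) (r : ℝ) {δ : ℝ} (hδ : 0 < δ) (M : ℕ) :
    ∃ l, 0 < l ∧ ∃ D E,
      IsCloseStep (approx p₀ q₀ w) (approx p₀ q₀ (⟨k, l, h⟩ :: w)) N r δ M D E := by
  have hH : IsSmoothDiffeo (h.trans (conj w)) := hh.diffeo.trans hw.isSmoothDiffeo_conj
  have hα := tendsto_alpha_cons hw hq hh.k_pos h
  have h1 := hα.eventually (eventually_isPerturbation_rotConj hH _ N r hδ)
  -- The inverses are the conjugated rotations by the opposite angles.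
  have h2 := hα.neg.eventually (eventually_isPerturbation_rotConj hH _ N r hδ)
  have h3 := hα.eventually (eventually_dist_iterate_rotConj (h.trans (conj w)) _ M hδ)
  obtain ⟨l, hl, ⟨D, hD, hD'⟩, ⟨E, hE, hE'⟩, hM⟩ :=
    ((eventually_gt_atTop 0).and (h1.and (h2.and h3))).exists
  refine ⟨l, hl, D, E, ?_⟩
  rw [approx_eq_rotConj_of_allowed hh, approx_eq_rotConj]
  exact ⟨hD, by rw [rotConj_symm, rotConj_symm]; exact hE, hD', hE',
    fun i hi x => (hM i hi x).le⟩

theorem IsCloseStep.diffDist_le {f g : S.Pt ≃ₜ S.Pt} {N M : ℕ} {r δ : ℝ} {D E : ℂ → ℂ}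
    (h : IsCloseStep f g N r δ M D E) (hf : IsSmoothDiffeo f) (hr : 2 ≤ r) {k : ℕ} (hk : k ≤ N) :
    diffDist k f g ≤ ENNReal.ofReal δ := by
  have hcell : S.cell ⊆ S.domain ∩ Metric.closedBall 0 r := fun z hz =>
    ⟨S.cell_subset_domain hz, Metric.closedBall_subset_closedBall hr (S.cell_subset_closedBall hz)⟩
  exact max_le
    (h.pert.semiDist_le hf fun j hj z hz => h.norm_le j (hj.trans hk) z (hcell hz))
    (h.pert_symm.semiDist_le hf.symm fun j hj z hz => h.norm_symm_le j (hj.trans hk) z (hcell hz))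

end AbC

/-! ### Vanishing of the slow entropy -/

theorem exists_le_le_of_strictMono {M : ℕ → ℕ} (hM : StrictMono M) {N j : ℕ} (hj : M N ≤ j) :
    ∃ n ≥ N, M n ≤ j ∧ j ≤ M (n + 1) := by
  induction j, hj using Nat.le_induction with
  | base => exact ⟨N, le_rfl, le_rfl, (hM N.lt_succ_self).le⟩
  | succ j _ ih =>
    obtain ⟨n, hn, h1, h2⟩ := ih
    rcases h2.lt_or_eq with h | h
    · exact ⟨n, hn, by omega, h⟩
    · exact ⟨n + 1, by omega, by omega, h ▸ hM (n + 1).lt_succ_self⟩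

theorem tendsto_iterate_of_tendstoUniformly {X : Type*} [PseudoMetricSpace X] {f : ℕ → X ≃ₜ X}
    {T : X ≃ₜ X} (h : TendstoUniformly (fun n => f n) T atTop) (i : ℕ) (x : X) :
    Tendsto (fun n => (f n)^[i] x) atTop (𝓝 (T^[i] x)) := by
  induction i with
  | zero => exact tendsto_const_nhds
  | succ i ih =>
    simp only [Function.iterate_succ_apply']
    exact h.tendsto_comp T.continuous.continuousAt ih

theorem upperTopSlowEntropy_eq_zero {a : ℕ → ℝ → ℝ}
    {X : Type*} [PseudoMetricSpace X] {T : X ≃ₜ X}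
    (h : ∀ ε > 0, ∀ t > 0, ∀ r > 0, ∀ᶠ n in atTop, ∃ C : Finset X,
      (∀ y, ∃ x ∈ C, y ∈ bowenBall T n ε x) ∧ (C.card : ℝ) ≤ r * a n t) :
    upperTopSlowEntropy a T = 0 := by
  simp only [upperTopSlowEntropy, slowEntropyAt, ENNReal.iSup_eq_zero]
  rintro K - ε hε t ⟨ht, hlim⟩
  refine absurd hlim (not_lt.2 (le_of_eq (Tendsto.limsup_eq ?_)))
  rw [ENNReal.tendsto_nhds_zero]
  intro δ hδ
  obtain ⟨r, hr0, hr⟩ := ENNReal.lt_iff_exists_nnreal_btwn.1 hδ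
  filter_upwards [h ε hε t ht r (by exact_mod_cast hr0)] with n hn
  obtain ⟨C, hC, hcard⟩ := hn
  refine ENNReal.div_le_of_le_mul ?_
  have h1 : bowenCoveringNumber T K ε n ≤ C.card :=
    iInf₂_le C fun y _ => mem_iUnion₂.2 (by
      obtain ⟨x, hx, hxy⟩ := hC y
      exact ⟨x, hx, hxy⟩)
  calc (bowenCoveringNumber T K ε n : ℝ≥0∞) ≤ ((C.card : ℕ∞) : ℝ≥0∞) := by exact_mod_cast h1
    _ = ENNReal.ofReal C.card := by simp
    _ ≤ ENNReal.ofReal (r * a n t) := ENNReal.ofReal_le_ofReal hcard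
    _ = r * ENNReal.ofReal (a n t) := by
      rw [ENNReal.ofReal_mul r.coe_nonneg, ENNReal.ofReal_coe_nnreal]
    _ ≤ δ * ENNReal.ofReal (a n t) := by gcongr

/-- For times `j` between `M n` and `M (n + 1)`, orbits of `T` stay close to those of `f (n + 1)`,
for which `C n` is a net at all times. From `M n` on, the scale exceeds `n + 1` times the
cardinality of `C n`, so the quotient in the entropy tends to `0`. -/
theorem upperTopSlowEntropy_eq_zero_of_approximation {a : ℕ → ℝ → ℝ} (ha : IsScale a)
    {X : Type*} [PseudoMetricSpace X] {f : ℕ → X ≃ₜ X} {T : X ≃ₜ X}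
    (hT : TendstoUniformly (fun n => f n) T atTop) {M : ℕ → ℕ} (hM : StrictMono M)
    {C : ℕ → Finset X}
    (hC : ∀ n y, ∃ x ∈ C n, ∀ i, dist ((f (n + 1))^[i] x) ((f (n + 1))^[i] y) < 1 / (n + 1 : ℝ))
    (haC : ∀ n, ∀ j ≥ M n, (n + 1 : ℝ) * (C n).card ≤ a j (1 / (n + 1 : ℝ)))
    (hf : ∀ n, ∀ i ≤ M n, ∀ x, dist ((f n)^[i] x) ((f (n + 1))^[i] x) ≤ (1 / 2) ^ n) :
    upperTopSlowEntropy a T = 0 := by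
  have hdist : ∀ n, ∀ i ≤ M n, ∀ x, dist ((f n)^[i] x) (T^[i] x) ≤ 2 * (1 / 2) ^ n :=
    fun n i hi x => by
      refine le_of_tendsto (tendsto_const_nhds.dist (tendsto_iterate_of_tendstoUniformly hT i x)) ?_
      filter_upwards [eventually_ge_atTop n] with k hk
      exact dist_le_of_le_geometric (u := fun k => (f k)^[i] x)
        (fun k hk => hf k i (hi.trans (hM.monotone hk)) x) hk
  refine upperTopSlowEntropy_eq_zero fun ε hε t ht r hr => ?_
  have h1 : Tendsto (fun n : ℕ => 1 / (n + 1 : ℝ)) atTop (𝓝 0) :=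
    tendsto_one_div_add_atTop_nhds_zero_nat
  -- The mesh of the net, plus the distance `2 * (1 / 2) ^ (n + 1)` between the orbits of `T` and `f
  -- (n + 1)`, once for each of the two points.
  have h2 : Tendsto (fun n : ℕ => 1 / (n + 1 : ℝ) + 4 * (1 / 2) ^ (n + 1)) atTop (𝓝 0) := by
    have := h1.add (((tendsto_pow_atTop_nhds_zero_of_lt_one (r := (1 / 2 : ℝ)) (by norm_num)
      (by norm_num)).comp (tendsto_add_atTop_nat 1)).const_mul 4)
    simpa using this
  obtain ⟨N, hN⟩ := eventually_atTop.1 ((h1.eventually_lt_const ht).and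
    ((h1.eventually_lt_const hr).and (h2.eventually_lt_const hε)))
  obtain ⟨N', hN'⟩ := ha.eventually_mono_param
  filter_upwards [eventually_ge_atTop (M N), eventually_ge_atTop N'] with j hj hj'
  obtain ⟨n, hn, hnj, hjn⟩ := exists_le_le_of_strictMono hM hj
  obtain ⟨hnt, hnr, hnε⟩ := hN n hn
  refine ⟨C n, fun y => ?_, ?_⟩
  · obtain ⟨x, hx, hxy⟩ := hC n y
    refine ⟨x, hx, fun i hi => ?_⟩
    have hi' : i ≤ M (n + 1) := by omega
    have := dist_triangle4 (T^[i] x) ((f (n + 1))^[i] x) ((f (n + 1))^[i] y) (T^[i] y)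
    have := dist_comm (T^[i] x) ((f (n + 1))^[i] x)
    linarith [hxy i, hdist (n + 1) i hi' x, hdist (n + 1) i hi' y]
  · have hn0 : (0 : ℝ) < 1 / (n + 1) := by positivity
    have h3 := haC n j hnj
    have h4 := hN' j hj' _ hn0 t hnt.le
    have h5 : ((C n).card : ℝ) ≤ 1 / (n + 1) * a j t := by
      rw [div_mul_eq_mul_div, one_mul, le_div_iff₀ (by positivity)]
      linarith
    have h6 : 0 ≤ a j t := by
      refine le_trans ?_ (h3.trans h4)
      positivity
    exact h5.trans (by gcongr)

/-! ### The construction -/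

namespace AbC

open Surface

variable {S : Surface} {p₀ : ℤ} {q₀ : ℕ}

theorem exists_construction {ε : ℕ → ℝ} (hε : ∀ n, 0 < ε n) (m : ℕ → ℕ) {a : ℕ → ℝ → ℝ}
    (ha : IsScale a) (hq : 0 < q₀) {ρ : Rule S} (hρ : ρ.IsAdmissible p₀ q₀) :
    ∃ c : ℕ → Stage S, IsConstruction ε m p₀ q₀ c ∧ ρ.IsObeyedBy c ∧
      ∃ T : S.Pt ≃ₜ S.Pt, ConvergesTo p₀ q₀ c T ∧ upperTopSlowEntropy a T = 0 := by
  -- Net and threshold depend on the history and the prescribed `h`, not on the `l` of the current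
  -- stage, which can thus be chosen after them.
  have hcover : ∀ w : List (Stage S), ∃ C : Finset S.Pt, ∃ M : ℕ,
      (∀ y, ∃ x ∈ C, ∀ t, dist (rotConj ((ρ.h w).trans (conj w)) t x)
        (rotConj ((ρ.h w).trans (conj w)) t y) < 1 / (w.length + 1 : ℝ)) ∧
      ∀ j ≥ M, (w.length + 1 : ℝ) * C.card ≤ a j (1 / (w.length + 1 : ℝ)) := fun w => by
    have hpos : (0 : ℝ) < 1 / (w.length + 1) := by positivity
    obtain ⟨C, hC⟩ := exists_finset_rotConj ((ρ.h w).trans (conj w)) hpos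
    obtain ⟨M, hM⟩ := eventually_atTop.1
      ((ha.tendsto_atTop _ hpos).eventually_ge_atTop ((w.length + 1 : ℝ) * C.card))
    exact ⟨C, M, hC, hM⟩
  choose C M hC hM using hcover
  -- The thresholds are enlarged so as to increase strictly along a history.
  let Mx : List (Stage S) → ℕ := fun w => List.rec (M []) (fun s w r => max (M (s :: w)) (r + 1)) w
  have hMx : ∀ w, M w ≤ Mx w := fun w => by
    cases w with
    | nil => exact le_rfl
    | cons s w => exact le_max_left _ _
  have hMx' : ∀ s w, Mx w < Mx (s :: w) := fun s w => le_max_right (M (s :: w)) (Mx w + 1)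
  have hstep : ∀ w : List (Stage S), ValidHistory p₀ q₀ w → ∃ l, 0 < l ∧ ∃ D E,
      IsCloseStep (approx p₀ q₀ w) (approx p₀ q₀ (⟨ρ.k w, l, ρ.h w⟩ :: w))
        -- Order `n`, radius `n + 2` and size `(1 / 2) ^ n` give smooth convergence; order `m n` and
        -- size `ε n / 2` give the strict bound on `d_{m_n}`.
        (max w.length (m w.length)) (w.length + 2) (min ((1 / 2) ^ w.length) (ε w.length / 2))
        (Mx w) D E := fun w hw =>
    exists_isCloseStep hw hq (hρ w hw) _ _
      (lt_min (by positivity) (half_pos (hε _))) _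
  choose! l hl D E hDE using hstep
  let W : ℕ → List (Stage S) := fun n => Nat.rec [] (fun _ w => ⟨ρ.k w, l w, ρ.h w⟩ :: w) n
  let c : ℕ → Stage S := fun n => ⟨ρ.k (W n), l (W n), ρ.h (W n)⟩
  have hW : ∀ n, W (n + 1) = c n :: W n := fun n => rfl
  have hhist : ∀ n, history c n = W n := fun n => by
    induction n with
    | zero => rfl
    | succ n ih => rw [hW, ← ih]; rfl
  have hvalid : ∀ n, ValidHistory p₀ q₀ (W n) := fun n => by
    induction n with
    | zero => trivial
    | succ n ih => exact ⟨ih, hl _ ih, hρ _ ih⟩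
  have hlen : ∀ n, (W n).length = n := fun n => by
    induction n with
    | zero => rfl
    | succ n ih => rw [hW, List.length_cons, ih]
  let f : ℕ → S.Pt ≃ₜ S.Pt := fun n => approx p₀ q₀ (W n)
  have hf : ∀ n, IsSmoothDiffeo (f n) := fun n => (hvalid n).isSmoothDiffeo_conj.rotConj _
  have hclose : ∀ n : ℕ, IsCloseStep (f n) (f (n + 1)) (max n (m n)) (n + 2)
      (min ((1 / 2) ^ n) (ε n / 2)) (Mx (W n)) (D (W n)) (E (W n)) := fun n => by
    have := hDE _ (hvalid n)
    rwa [hlen] at this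
  obtain ⟨T, hTs, hTd, hTu⟩ := exists_limit (D := fun n => D (W n)) (E := fun n => E (W n)) hf
    (fun n => (hclose n).pert)
    (fun n j hj z hz => ((hclose n).norm_le j (le_max_of_le_left hj) z hz).trans (min_le_left _ _))
    (fun n => (hclose n).pert_symm)
    (fun n j hj z hz =>
      ((hclose n).norm_symm_le j (le_max_of_le_left hj) z hz).trans (min_le_left _ _))
  refine ⟨c, ⟨hq, fun n => hl _ (hvalid n), fun n => ?_, fun n => ?_⟩, fun n => ?_, T,
    ⟨hTs, fun k => ?_⟩, ?_⟩
  · rw [hhist]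
    exact hρ _ (hvalid n)
  · rw [hhist, hhist]
    refine ((hclose n).diffDist_le (hf n) (by simp) (le_max_right _ _)).trans_lt ?_
    rw [ENNReal.ofReal_lt_ofReal_iff (hε n)]
    exact (min_le_right _ _).trans_lt (half_lt_self (hε n))
  · rw [hhist]
    exact ⟨rfl, rfl⟩
  · simpa only [hhist] using hTd k
  · refine upperTopSlowEntropy_eq_zero_of_approximation ha hTu (M := fun n => Mx (W n))
      (strictMono_nat_of_lt_succ fun n => hMx' _ _) (C := fun n => C (W n)) (fun n y => ?_)
      (fun n j hj => ?_)
      fun n i hi x => ((hclose n).dist_iterate_le i hi x).trans (min_le_left _ _)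
    · obtain ⟨x, hx, hxy⟩ := hC (W n) y
      refine ⟨x, hx, fun i => ?_⟩
      -- The `i`-th iterate is the conjugated rotation by `i` times the angle, so the net property
      -- for all `t` covers all times.
      have := hxy (i * alpha p₀ q₀ (W (n + 1)))
      rw [hlen] at this
      change dist ((rotConj (conj (W (n + 1))) (alpha p₀ q₀ (W (n + 1))))^[i] x)
        ((rotConj (conj (W (n + 1))) (alpha p₀ q₀ (W (n + 1))))^[i] y) < _
      rw [iterate_rotConj, iterate_rotConj]
      exact this
    · have := hM (W n) j ((hMx _).trans hj)
      rwa [hlen] at this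

/-- An admissible rule exists, so the first claim of the theorem follows from the second. -/
theorem isAdmissible_refl (p₀ : ℤ) (q₀ : ℕ) :
    Rule.IsAdmissible (S := S) ⟨fun _ => 1, fun _ => Homeomorph.refl _⟩ p₀ q₀ :=
  fun _ _ => ⟨one_pos, .refl, fun _ => rfl⟩

end AbC

theorem mainTheorem6 (S : Surface)
    (ε : ℕ → ℝ) (hε_pos : ∀ n, 0 < ε n) (hε_sum : Summable ε)
    (hε_tail : ∀ᶠ n₀ in atTop, ∑' n, ε (n₀ + 1 + n) < ε n₀)
    (m : ℕ → ℕ) (hm_pos : ∀ n, 0 < m n) (hm_mono : Monotone m)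
    (a : ℕ → ℝ → ℝ) (ha : IsScale a) :
    (∃ T : S.Pt ≃ₜ S.Pt, AbC.IsAbCDiffeo ε m T ∧ upperTopSlowEntropy a T = 0) ∧
    ∀ (p₀ : ℤ) (q₀ : ℕ), 0 < q₀ → ∀ ρ : AbC.Rule S, ρ.IsAdmissible p₀ q₀ →
      ∃ c : ℕ → AbC.Stage S, AbC.IsConstruction ε m p₀ q₀ c ∧ ρ.IsObeyedBy c ∧
        ∃ T : S.Pt ≃ₜ S.Pt, AbC.ConvergesTo p₀ q₀ c T ∧ upperTopSlowEntropy a T = 0 := by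
  refine ⟨?_, fun p₀ q₀ hq ρ hρ => AbC.exists_construction hε_pos m ha hq hρ⟩
  obtain ⟨c, hc, -, T, hT, h⟩ := AbC.exists_construction hε_pos m ha one_pos
    (AbC.isAdmissible_refl (S := S) 0 1)
  exact ⟨T, ⟨0, 1, c, hc, hT⟩, h⟩
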